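/- Let $(X,Y)$ be a double affine datum: two irreducible reduced root data of finite type, with lattices $Q^X\subset X\subset P^X$ and $Q^Y\subset Y\subset P^Y$ between root and weight lattices, with simple roots indexed by the same set $I_0$, together with an isomorphism $W_0=W_0(X)\cong W_0(Y)$ matching the simple reflections. Thus the Cartan matrices of $X$ and $Y$ are either transposes of each other (untwisted type) or equal (dual untwisted type). Let $\vartheta$ be the dominant short root of $X$, and let $\theta$ be the highest root of $Y$ in untwisted type and the dominant short root of $Y$ in dual untwisted type. Let $(\cdot,\cdot):X_{\mathbb Q}\times Y_{\mathbb Q}\to\mathbb Q$ be the bilinear pairing with $(x,\alpha_i^Y)=\gamma_i\langle\alpha_i^{\vee X},x\rangle$ for $i\in I_0$, where $\gamma_i=1$ in untwisted type and, in dual untwisted type, $\gamma_i$ is the ratio of the square length of $\alpha_i^Y$ to that of a short root of $Y$. Let $W(\tilde Y)=X\rtimes W_0$ act on $Y_{\mathbb Q}\oplus\mathbb Q\delta$, where $W_0$ acts on $Y_{\mathbb Q}$ and fixes $\delta$, and $t_x(y+a\delta)=y+(a-(x,y))\delta$ for $x\in X$. Write $w=t_{\mathrm{wt}(w)}\,\mathrm{dir}(w)$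 for $w\in W(\tilde Y)$. The simple affine roots are $\alpha_i=\alpha_i^Y$ $(i\in I_0)$ and $\alpha_0=\delta-\theta$; the simple reflections are $s_i\in W_0$ $(i\in I_0)$ and $s_0=t_\vartheta s_\vartheta$; put $I=I_0\cup\{0\}$. Let $\Pi^Y\subset W(\tilde Y)$ be the subgroup of elements permuting the simple affine roots. The length of $w\in W(\tilde Y)$ is the least $n$ such that $w=\pi s_{i_1}\cdots s_{i_n}$ with $\pi\in\Pi^Y$ and $i_k\in I$. Let $\ell$ be the length function of $W_0$, let $R_+(Y)$ be the set of positive roots, and let $2\rho^{\vee Y}$ be the sum of the positive coroots of $Y$, extended by $\langle 2\rho^{\vee Y},\delta\rangle=0$. For $\beta=\bar\beta+a\delta$ with $\bar\beta\in Y_{\mathbb Q}$ put $\deg\beta=a$. Let $u\in W(\tilde Y)$ and $\lambda\in X$, let $m_\lambda$ be the element of minimum length in the coset $t_\lambda W_0$, and fix a reduced expression $m_\lambda=\pi s_{i_1}\cdots s_{i_n}$ with $\pi\in\Pi^Y$. Put $\beta_j=s_{i_n}\cdots s_{i_{j+1}}\alpha_{i_j}$. The alcove paths $p_J\in\mathcal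 B(u;m_\lambda)$ are indexed by the subsets $J=\{j_1<\dots<j_r\}\subset\{1,\dots,n\}$. For given $J$, put $z_0=um_\lambda$, $z_k=z_{k-1}s_{\beta_{j_k}}$ and $\mathrm{dir}(p_J)=\mathrm{dir}(z_r)$. Put $u_0=u\pi$, and $u_j=u_{j-1}$ if $j\in J$, $u_j=u_{j-1}s_{i_j}$ if $j\notin J$. Let $J^{\pm}$ be the set of $j\in J$ with $u_{j-1}\alpha_{i_j}\in\mathbb Z\delta\pm R_+(Y)$, and put $\mathrm{qwt}(p_J)=\sum_{j\in J^-}\beta_j$. Let $\mathrm{ord}(p_J)$ be the order in $v$ of $$v^{\ell(\mathrm{dir}(p_J))}\prod_{j\in J^+}\frac{(v^{-1}-v)(1+\xi_j)}{1-\xi_j^2}\prod_{j\in J^-}\frac{(v^{-1}-v)(\xi_j^2+\xi_j)}{1-\xi_j^2},\qquad \xi_j=q^{\deg\beta_j}v^{\langle2\rho^{\vee Y},-\bar\beta_j\rangle},$$ the coefficient of $p_J$ in the equal-parameter Ram–Yip formula, where $q$ and $v$ are independent indeterminates over a field. Then for every $J\subset\{1,\dots,n\}$: $$\mathrm{ord}(p_J)=\ell(\mathrm{dir}(p_J))-|J|-\langle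 2\rho^{\vee Y},\mathrm{qwt}(p_J)\rangle ,\qquad \mathrm{ord}(p_J)\ge\mathrm{ord}(p_\emptyset),$$ and $\mathrm{ord}(p_J)=\mathrm{ord}(p_\emptyset)$ if and only if $$\mathrm{dir}(z_0)\xrightarrow{-\bar\beta_{j_1}}\mathrm{dir}(z_1)\xrightarrow{-\bar\beta_{j_2}}\cdots\xrightarrow{-\bar\beta_{j_r}}\mathrm{dir}(z_r)$$ is a path in the quantum Bruhat graph, the directed graph on $W_0$ that has an edge $w\xrightarrow{\alpha}ws_\alpha$, for $w\in W_0$ and $\alpha\in R_+(Y)$, whenever $\ell(ws_\alpha)=\ell(w)+1$ or $\ell(ws_\alpha)=\ell(w)-\langle2\rho^{\vee Y},\alpha\rangle+1$. -/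

import Mathlib

noncomputable section

/-- The positive root of greatest height of a finite root system with a base: the highest root. -/
def highestRootIdx {ι V V' : Type*} [Fintype ι] [Nonempty ι] [AddCommGroup V] [Module ℚ V]
    [AddCommGroup V'] [Module ℚ V'] {P : RootPairing ι ℚ V V'} (b : P.Base) : ι :=
  (Finite.exists_max b.height).choose

/-- The dominant short root: the root whose associated coroot is the highest coroot. -/
def dominantShortRootIdx {ι V V' : Type*} [Fintype ι] [Nonempty ι] [AddCommGroup V] [Module ℚ V]
    [AddCommGroup V'] [Module ℚ V'] {P : RootPairing ι ℚ V V'} (b : P.Base) : ι :=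
  highestRootIdx b.flip

/-- The two kinds of double affine data. For simply laced data both kinds apply, and all the
constructions below then agree. -/
inductive AffineKind : Type
  | untwisted
  | dualUntwisted

/-- A double affine datum `(X, Y)`: two irreducible reduced root data of finite type, with an
isomorphism of their Weyl groups matching the simple reflections. Each root datum is given by a
root system in the rational span (`V = X_ℚ`, `U = Y_ℚ`), with a base, and a lattice between the
root lattice and the weight lattice. The set `I₀` of finite Dynkin nodes is `baseX.support`. -/
structure DoubleAffineDatum (ιX ιY V V' U U' : Type*) [Fintype ιX] [Fintype ιY]
    [AddCommGroup V] [Module ℚ V] [AddCommGroup V'] [Module ℚ V']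
    [AddCommGroup U] [Module ℚ U] [AddCommGroup U'] [Module ℚ U'] where
  /-- the root system of `X` -/
  PX : RootPairing ιX ℚ V V'
  /-- the root system of `Y` -/
  PY : RootPairing ιY ℚ U U'
  isRootSystemX : PX.IsRootSystem
  isRootSystemY : PY.IsRootSystem
  isCrystallographicX : PX.IsCrystallographic
  isCrystallographicY : PY.IsCrystallographic
  isReducedX : PX.IsReduced
  isReducedY : PY.IsReduced
  isIrreducibleX : PX.IsIrreducible
  isIrreducibleY : PY.IsIrreducible
  /-- the simple roots of `X` -/
  baseX : PX.Base
  /-- the simple roots of `Y` -/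
  baseY : PY.Base
  /-- the common labelling of the simple roots by the finite Dynkin nodes -/
  node : baseX.support ≃ baseY.support
  /-- the lattice `X`, with `Q^X ⊆ X ⊆ P^X` -/
  X : AddSubgroup V
  /-- the lattice `Y`, with `Q^Y ⊆ Y ⊆ P^Y` -/
  Y : AddSubgroup U
  root_mem_X : ∀ k, PX.root k ∈ X
  root_mem_Y : ∀ k, PY.root k ∈ Y
  X_le_weights : ∀ x ∈ X, ∀ k, ∃ n : ℤ, PX.coroot' k x = n
  Y_le_weights : ∀ y ∈ Y, ∀ k, ∃ n : ℤ, PY.coroot' k y = n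
  /-- the isomorphism `W₀(X) ≅ W₀(Y)` -/
  weylIso : PX.weylGroup ≃* PY.weylGroup
  weylIso_simple : ∀ i : baseX.support,
    weylIso (RootPairing.weylGroup.ofIdx PX i) = RootPairing.weylGroup.ofIdx PY (node i)
  /-- the type, untwisted or dual untwisted -/
  kind : AffineKind
  /-- `X` and `Y` have dual Cartan data in the untwisted case, and the same Cartan data in the
  dual untwisted case. -/
  cartan : match kind with
    | .untwisted => ∀ i j : baseX.support, PY.pairing (node i) (node j) = PX.pairing j i
    | .dualUntwisted => ∀ i j : baseX.support, PY.pairing (node i) (node j) = PX.pairing i j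

namespace DoubleAffineDatum

attribute [instance] isRootSystemX isRootSystemY isCrystallographicX isCrystallographicY
  isReducedX isReducedY isIrreducibleX isIrreducibleY

variable {ιX ιY V V' U U' : Type*} [Fintype ιX] [Fintype ιY]
  [AddCommGroup V] [Module ℚ V] [AddCommGroup V'] [Module ℚ V']
  [AddCommGroup U] [Module ℚ U] [AddCommGroup U'] [Module ℚ U']

theorem nonempty_X (D : DoubleAffineDatum ιX ιY V V' U U') : Nonempty ιX := by
  by_contra h
  rw [not_nonempty_iff] at h
  have := RootPairing.IsIrreducible.nontrivial D.PX
  have h1 := RootPairing.IsRootSystem.span_root_eq_top (P := D.PX)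
  rw [Set.range_eq_empty, Submodule.span_empty] at h1
  exact bot_ne_top h1

theorem nonempty_Y (D : DoubleAffineDatum ιX ιY V V' U U') : Nonempty ιY := by
  by_contra h
  rw [not_nonempty_iff] at h
  have := RootPairing.IsIrreducible.nontrivial D.PY
  have h1 := RootPairing.IsRootSystem.span_root_eq_top (P := D.PY)
  rw [Set.range_eq_empty, Submodule.span_empty] at h1
  exact bot_ne_top h1

variable (D : DoubleAffineDatum ιX ιY V V' U U')

/-! ### The finite Weyl group -/

/-- The finite Weyl group `W₀ = W₀(X)`; it acts on `V = X_ℚ`, and on `U = Y_ℚ` through the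
isomorphism with `W₀(Y)`. -/
abbrev W0 : Type _ := D.PX.weylGroup

/-- The Dynkin nodes `I₀` of finite type. -/
abbrev I0 : Type _ := D.baseX.support

/-- The length `ℓ` on `W₀`: the least number of factors in a product of simple reflections. -/
def length0 (w : D.W0) : ℕ :=
  sInf {n | ∃ word : Fin n → D.I0,
    w = (List.ofFn fun k => RootPairing.weylGroup.ofIdx D.PX (word k)).prod}

/-- The action of `W₀` on `U = Y_ℚ`. -/
def actY (w : D.W0) (y : U) : U := D.weylIso w • y

theorem smul_mem_X (w : D.W0) {x : V} (hx : x ∈ D.X) : w • x ∈ D.X := by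
  obtain ⟨w, hw⟩ := w
  induction hw using RootPairing.weylGroup.induction generalizing x with
  | mem k =>
    obtain ⟨n, hn⟩ := D.X_le_weights x hx k
    have h : (RootPairing.weylGroup.ofIdx D.PX k) • x = x - n • D.PX.root k := by
      rw [RootPairing.weylGroup.ofIdx_smul]
      have : RootPairing.Equiv.reflection D.PX k • x = D.PX.reflection k x := rfl
      rw [this, RootPairing.reflection_apply, hn, Int.cast_smul_eq_zsmul]
    change (RootPairing.weylGroup.ofIdx D.PX k) • x ∈ D.X
    rw [h]
    exact D.X.sub_mem hx (D.X.zsmul_mem (D.root_mem_X k) n)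
  | one => exact hx
  | mul a b ha hb iha ihb =>
    have := iha (ihb hx)
    rwa [← mul_smul] at this

/-- The action of `W₀` on the lattice `X`. -/
def latticeAction : D.W0 →* MulAut (Multiplicative D.X) where
  toFun w := AddEquiv.toMultiplicative
    { toFun := fun x => ⟨w • (x : V), D.smul_mem_X w x.2⟩
      invFun := fun x => ⟨w⁻¹ • (x : V), D.smul_mem_X w⁻¹ x.2⟩
      left_inv := fun x => by ext; simp
      right_inv := fun x => by ext; simp
      map_add' := fun x y => by ext; simp }
  map_one' := by ext x; exact one_smul _ _
  map_mul' a b := by ext x; exact mul_smul a b _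

/-! ### The affine root data of `Ỹ` and the extended affine Weyl group `W(Ỹ) = X ⋊ W₀` -/

/-- The dominant short root `ϑ` of `X`. -/
def varthetaIdx : ιX :=
  haveI := D.nonempty_X
  dominantShortRootIdx D.baseX

/-- The root `θ` of `Y` with `δ = α₀ + θ`: the highest root in the untwisted case, and the dominant
short root in the dual untwisted case. -/
def thetaIdx : ιY :=
  haveI := D.nonempty_Y
  match D.kind with
  | .untwisted => highestRootIdx D.baseY
  | .dualUntwisted => dominantShortRootIdx D.baseY

/-- The integers `γ_i`: all `1` in the untwisted case; in the dual untwisted case the symmetrizer of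
the Cartan matrix of `Y` that is `1` at short roots, that is, the ratio of the square length of the
simple root `α_i` of `Y` to that of a short root. -/
def gam (i : D.I0) : ℚ :=
  match D.kind with
  | .untwisted => 1
  | .dualUntwisted =>
    D.PY.RootForm (D.PY.root (D.node i)) (D.PY.root (D.node i)) /
      D.PY.RootForm (D.PY.root D.thetaIdx) (D.PY.root D.thetaIdx)

/-- The `W₀`-invariant pairing `X_ℚ × Y_ℚ → ℚ`, determined by
`(x, α_i^Y) = γ_i ⟨α_i^{∨X}, x⟩` for `i ∈ I₀`. -/
def latticePairing : V →ₗ[ℚ] U →ₗ[ℚ] ℚ :=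
  ∑ i : D.I0, D.gam i •
    (D.PX.coroot' i).smulRight (D.baseY.toWeightBasis.coord (D.node i))

/-- The group `W(Ỹ) = X ⋊ W₀`. An element `w = t_x d` has `wt w = x` and `dir w = d`. -/
abbrev W : Type _ := Multiplicative D.X ⋊[D.latticeAction] D.W0

variable {D} in
/-- The translation part `wt w ∈ X` of `w = t_{wt w} dir w`. -/
def wt (w : D.W) : D.X := w.left.toAdd

variable {D} in
/-- The direction `dir w ∈ W₀` of `w = t_{wt w} dir w`. -/
def dir (w : D.W) : D.W0 := w.right

/-- The translation `t_x`. -/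
def transl (x : D.X) : D.W := SemidirectProduct.inl (Multiplicative.ofAdd x)

/-- The affine Dynkin nodes `I = I₀ ∪ {0}`; the affine node `0` is `none`. -/
abbrev I : Type _ := Option D.I0

/-- The simple reflections of `W(Ỹ)`: `s_i ∈ W₀` for `i ∈ I₀`, and `s₀ = t_ϑ s_ϑ`. -/
def s : D.I → D.W
  | some i => SemidirectProduct.inr (RootPairing.weylGroup.ofIdx D.PX i)
  | none => D.transl ⟨D.PX.root D.varthetaIdx, D.root_mem_X _⟩ *
      SemidirectProduct.inr (RootPairing.weylGroup.ofIdx D.PX D.varthetaIdx)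

/-- The simple affine roots in `Ỹ_ℚ = Y_ℚ ⊕ ℚ δ`, an element `y + a δ` being written `(y, a)`:
`α_i` for `i ∈ I₀`, and `α₀ = δ - θ`. -/
def affSimpleRoot : D.I → U × ℚ
  | some i => (D.PY.root (D.node i), 0)
  | none => (-D.PY.root D.thetaIdx, 1)

variable {D} in
/-- The action of `W(Ỹ)` on `Ỹ_ℚ`: here `w ∈ W₀` acts on `Y_ℚ` and fixes `δ`, and
`t_x (y + a δ) = y + (a - (x, y)) δ`. -/
def affAct (w : D.W) (y : U × ℚ) : U × ℚ :=
  (D.actY (dir w) y.1, y.2 - D.latticePairing (wt w : V) (D.actY (dir w) y.1))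

/-- The subset `Π^Y` of `W(Ỹ)` (the elements of length zero): those that permute the simple affine
roots. -/
def PiY : Set D.W :=
  {p | affAct p '' Set.range D.affSimpleRoot = Set.range D.affSimpleRoot}

variable {D} in
/-- `w = p s_{i_1} ⋯ s_{i_n}` with `p ∈ Π^Y`, where `word = (i_1, …, i_n)`. -/
def IsExpression (w p : D.W) {n : ℕ} (word : Fin n → D.I) : Prop :=
  p ∈ D.PiY ∧ w = p * (List.ofFn fun k => D.s (word k)).prod

variable {D} in
/-- The length of an element of `W(Ỹ)`. -/
def length (w : D.W) : ℕ :=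
  sInf {n | ∃ (p : D.W) (word : Fin n → D.I), IsExpression w p word}

variable {D} in
/-- The expression `w = p s_{i_1} ⋯ s_{i_n}` is reduced. -/
def IsReducedExpression (w p : D.W) {n : ℕ} (word : Fin n → D.I) : Prop :=
  IsExpression w p word ∧ n = length w

/-- `m = m_x` is the element of minimum length in the coset `t_x W₀`. -/
def IsMinCosetRep (x : D.X) (m : D.W) : Prop :=
  (∃ g : D.W0, m = D.transl x * SemidirectProduct.inr g) ∧
    ∀ g : D.W0, length m ≤ length (D.transl x * SemidirectProduct.inr g)

/-! ### The quantum Bruhat graph -/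

open scoped Classical in
/-- The functional `⟨2ρ^{∨Y}, ·⟩`, where `2ρ^{∨Y}` is the sum of the positive coroots of `Y`. -/
def twoRhoCheck (y : U) : ℚ :=
  ∑ k : ιY, if D.baseY.IsPos k then D.PY.coroot' k y else 0

/-- There is an edge `w ⟶ w s_α = w'` with label `α ∈ R₊(Y)` in the quantum Bruhat graph. -/
def QBEdge (w w' : D.W0) (α : U) : Prop :=
  ∃ k : ιY, D.baseY.IsPos k ∧ D.PY.root k = α ∧
    D.weylIso w' = D.weylIso w * RootPairing.weylGroup.ofIdx D.PY k ∧
    (D.length0 w' = D.length0 w + 1 ∨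
      (D.length0 w' : ℚ) = D.length0 w - D.twoRhoCheck α + 1)

/-! ### Alcove paths

In this section `p s_{i_1} ⋯ s_{i_n}` is an expression of an element of `W(Ỹ)`, with
`word = (i_1, …, i_n)`; positions are numbered from `0` to `n - 1` in the formal text. The alcove
path `p_J ∈ B(u; p s_{i_1} ⋯ s_{i_n})` is given by the set `J` of its folds. -/

section AlcovePath

variable {D} {n : ℕ} (u p : D.W) (word : Fin n → D.I) (J : Finset (Fin n))

/-- The element `s_{i_n} ⋯ s_{i_{j+1}}`. -/
def tailElt (j : Fin n) : D.W :=
  (((List.ofFn fun k => D.s (word k)).drop (j + 1)).reverse).prod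

/-- The affine root `β_j = s_{i_n} ⋯ s_{i_{j+1}} α_{i_j}`. -/
def beta (j : Fin n) : U × ℚ := affAct (tailElt word j) (D.affSimpleRoot (word j))

/-- The reflection `s_{β_j}`, for `β_j = g α_{i_j}` the element `g s_{i_j} g⁻¹`. -/
def sBeta (j : Fin n) : D.W := tailElt word j * D.s (word j) * (tailElt word j)⁻¹

/-- The element `u_{j-1} = u p s_{i_1}^{b_1} ⋯ s_{i_{j-1}}^{b_{j-1}}`, where `b_k = 0` for `k ∈ J`
and `b_k = 1` otherwise. -/
def before (j : Fin n) : D.W :=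
  u * p * ((List.ofFn fun k => if k ∈ J then 1 else D.s (word k)).take j).prod

/-- The `j`-th sign `ε_j` is `1`: `u_{j-1} α_{i_j} ∈ ℤδ + R₊(Y)`. -/
def SignPos (j : Fin n) : Prop :=
  ∃ (a : ℤ) (k : ιY), D.baseY.IsPos k ∧
    affAct (before u p word J j) (D.affSimpleRoot (word j)) = (D.PY.root k, (a : ℚ))

/-- The `j`-th sign `ε_j` is `-1`: `u_{j-1} α_{i_j} ∈ ℤδ - R₊(Y)`. -/
def SignNeg (j : Fin n) : Prop :=
  ∃ (a : ℤ) (k : ιY), D.baseY.IsPos k ∧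
    affAct (before u p word J j) (D.affSimpleRoot (word j)) = (-D.PY.root k, (a : ℚ))

open scoped Classical in
/-- The positive folds `J⁺`. -/
def foldsPos : Finset (Fin n) := {j ∈ J | SignPos u p word J j}

open scoped Classical in
/-- The negative folds `J⁻`. -/
def foldsNeg : Finset (Fin n) := {j ∈ J | SignNeg u p word J j}

/-- `qwt(p_J)`, the sum of the `β_j` over the negative folds. -/
def qwt : U × ℚ := ∑ j ∈ foldsNeg u p word J, beta word j

/-- The start `z_0 = u p s_{i_1} ⋯ s_{i_n}` of the sequence `z_0, …, z_r`. -/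
def zStart : D.W := u * (p * (List.ofFn fun k => D.s (word k)).prod)

/-- `end(p_J) = z_r`, where `J = {j_1 < ⋯ < j_r}` and `z_m = z_{m-1} s_{β_{j_m}}`. -/
def pathEnd : D.W :=
  (J.sort (· ≤ ·)).foldl (fun z j => z * sBeta word j) (zStart u p word)

/-- Starting from `z`, the directions of the successive elements `z s_{β_{j_1}}`,
`z s_{β_{j_1}} s_{β_{j_2}}`, … form a path in the quantum Bruhat graph, the step at `j` having the
label `-β̄_j`. -/
def IsQBPathFrom : D.W → List (Fin n) → Prop
  | _, [] => True
  | z, j :: js => D.QBEdge (dir z) (dir (z * sBeta word j)) (-(beta word j).1) ∧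
      IsQBPathFrom (z * sBeta word j) js

/-- `p_J` is a quantum alcove path, `p_J ∈ QB(u; p s_{i_1} ⋯ s_{i_n})`. -/
def IsQuantumAlcovePath : Prop :=
  IsQBPathFrom word (zStart u p word) (J.sort (· ≤ ·))

/-! ### The summands of the Ram–Yip formula with equal parameters

The coefficients are taken in `F(q)((v)) ⊇ F(q)(v)`. The exponents `⌊·⌋` below are taken at rational
numbers that are integers. -/

variable (F : Type*) [Field F]

/-- The scalar `v`. -/
def vElt : LaurentSeries (RatFunc F) := HahnSeries.single 1 1

/-- The scalar `q`. -/
def qElt : LaurentSeries (RatFunc F) := HahnSeries.C RatFunc.X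

/-- `ξ_j = q^{deg β_j} v^{⟨2ρ^{∨Y}, -β̄_j⟩}`, the eigenvalue of `Y^{-β_j}` on the generator of the
polynomial module for equal parameters. -/
def xi (j : Fin n) : LaurentSeries (RatFunc F) :=
  qElt F ^ ⌊(beta word j).2⌋ * vElt F ^ ⌊D.twoRhoCheck (-(beta word j).1)⌋

/-- The coefficient of `X^{wt(p_J)}` in the summand of `p_J`, where all the scalars `c_j` and `d_j`
are `v⁻¹ - v` and `v_{dir(p_J)} = v^{ℓ(dir(p_J))}`. -/
def summand : LaurentSeries (RatFunc F) :=
  vElt F ^ D.length0 (dir (pathEnd u p word J)) *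
    (∏ j ∈ foldsPos u p word J,
      (((vElt F)⁻¹ - vElt F) + ((vElt F)⁻¹ - vElt F) * xi word F j) / (1 - xi word F j ^ 2)) *
    ∏ j ∈ foldsNeg u p word J,
      (((vElt F)⁻¹ - vElt F) * xi word F j ^ 2 + ((vElt F)⁻¹ - vElt F) * xi word F j) /
        (1 - xi word F j ^ 2)

/-- `ord(p_J)`, the order in `v` of the summand of `p_J`. -/
def ord : ℤ := (summand u p word J F).order

end AlcovePath

end DoubleAffineDatum

end

/-! Write `α = -β̄_j`. Because `m_λ` is shortest in `t_λ W₀`, every such `α` is a positive root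
(`exists_pos_neg_beta`). Hence `ξ_j` has order `⟨2ρ^∨, α⟩ > 0` in `v`, the series `1 + ξ_j` and `1 -
ξ_j²` have order 0, and a fold contributes `-1` to the order, plus `⟨2ρ^∨, α⟩` if it is negative.
This is the formula for `ord` (`ord_eq`).

For the inequality, follow `z_0, …, z_r`. A fold replaces `z` by `z s_β`, and its sign is the sign
of `dir(z) α`. At a positive fold the length of the direction grows by at least 1; at a negative one
it falls by at most `ℓ(s_α) ≤ ⟨2ρ^∨, α⟩ - 1` (`length0_reflection_le`). So `ℓ(dir z)` is at most
`ℓ(dir (z s_β))` plus the contribution of the fold, with equality exactly at an edge of the quantum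
Bruhat graph (`fold_step`). Summing gives `ord(p_∅) = ℓ(dir z_0) ≤ ord(p_J)`, and the sum is an
equality only if every step is (`path_cost`).

Positivity of `α` rests on the strong exchange condition in `W(Ỹ)` (`exists_erase_of_not_affPos`).
It holds because `W(Ỹ)` permutes the affine roots `β + n c_β δ`, and the coordinates of each in the
simple affine roots all have one sign. The latter says that `c_β θ` dominates `β` (`repr_root_le`).
In both types this reduces to the fact that the highest root of an irreducible system dominates all
roots, applied to the coroots of `X`: the highest coroot is that of `ϑ`, and `ϑ` corresponds to `θ`.
-/

namespace RootPairing

/-! ### Weyl group actions and conjugation of reflections. -/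

section Weyl

variable {ι M N : Type*} [AddCommGroup M] [Module ℚ M] [AddCommGroup N] [Module ℚ N]
  {P : RootPairing ι ℚ M N}

theorem weylGroup_smul_root (g : P.weylGroup) (k : ι) : g • P.root k = P.root (g • k) :=
  weylGroup_apply_root P g k

theorem weylGroup_ext {g h : P.weylGroup} (H : ∀ y : M, g • y = h • y) : g = h :=
  Subtype.ext (Equiv.weightHom_injective P (LinearEquiv.ext H))

theorem weylGroup.ofIdx_smul_eq (k : ι) (y : M) :
    weylGroup.ofIdx P k • y = y - P.coroot' k y • P.root k := by
  rw [weylGroup.ofIdx_smul, Equiv.reflection_smul, reflection_apply]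

theorem coroot'_weylGroup_smul (g : P.weylGroup) (k : ι) (y : M) :
    P.coroot' (g • k) (g • y) = P.coroot' k y := by
  obtain ⟨g, hg⟩ := g
  induction hg using weylGroup.induction generalizing k y with
  | mem i =>
    change P.coroot' (P.reflectionPerm i k) (P.reflection i y) = _
    rw [← coroot'_reflection, reflection_same]
  | one => rfl
  | mul a b ha hb iha ihb =>
    have := (iha ((⟨b, hb⟩ : P.weylGroup) • k) ((⟨b, hb⟩ : P.weylGroup) • y)).trans (ihb k y)
    rwa [← mul_smul, ← mul_smul] at this

theorem weylGroup.conj_ofIdx (g : P.weylGroup) (k : ι) :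
    g * weylGroup.ofIdx P k * g⁻¹ = weylGroup.ofIdx P (g • k) := by
  refine weylGroup_ext fun y => ?_
  rw [mul_smul, mul_smul, ofIdx_smul_eq, ofIdx_smul_eq, smul_sub, smul_inv_smul, smul_comm,
    weylGroup_smul_root, ← coroot'_weylGroup_smul g k, smul_inv_smul]

theorem weylGroup.ofIdx_mul_self (k : ι) : weylGroup.ofIdx P k * weylGroup.ofIdx P k = 1 := by
  refine weylGroup_ext fun y => ?_
  rw [mul_smul, ofIdx_smul, ofIdx_smul, Equiv.reflection_smul, Equiv.reflection_smul,
    reflection_same, one_smul]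

theorem weylGroup.ofIdx_smul_idx (k l : ι) :
    weylGroup.ofIdx P k • l = P.reflectionPerm k l := rfl

end Weyl

theorem intCast_pairingIn {ι M N : Type*} [AddCommGroup M] [Module ℚ M] [AddCommGroup N]
    [Module ℚ N] (P : RootPairing ι ℚ M N) [P.IsCrystallographic] (i j : ι) :
    (P.pairingIn ℤ i j : ℚ) = P.pairing i j := by
  rw [← P.algebraMap_pairingIn ℤ, eq_intCast]

/-! ### Simple reflections, dominant roots and the highest root. -/

section Base

variable {ι M N : Type*} [Finite ι] [AddCommGroup M] [Module ℚ M] [AddCommGroup N] [Module ℚ N]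
  {P : RootPairing ι ℚ M N} [P.IsCrystallographic] [P.IsReduced] (b : P.Base)

theorem Base.exists_eq_smul_simple (k : ι) :
    ∃ (g : P.weylGroup) (i : b.support), k = g • (i : ι) := by
  induction k using b.induction_reflect with
  | h₀ k hk =>
    obtain ⟨g, i, rfl⟩ := hk
    exact ⟨weylGroup.ofIdx P (g • (i : ι)) * g, i, by rw [mul_smul]; rfl⟩
  | h₁ k hk => exact ⟨1, ⟨k, hk⟩, (one_smul _ _).symm⟩
  | h₂ k j hk hj =>
    obtain ⟨g, i, rfl⟩ := hk
    exact ⟨weylGroup.ofIdx P j * g, i, by rw [mul_smul]; rfl⟩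

theorem Base.exists_word (g : P.weylGroup) :
    ∃ L : List b.support, g = (L.map fun i : b.support => weylGroup.ofIdx P i).prod := by
  have key (k : ι) : ∃ L : List b.support,
      weylGroup.ofIdx P k = (L.map fun i : b.support => weylGroup.ofIdx P i).prod := by
    induction k using b.induction_reflect with
    | h₀ k hk =>
      rwa [← weylGroup.ofIdx_smul_idx, ← weylGroup.conj_ofIdx, mul_inv_cancel_right]
    | h₁ k hk => exact ⟨[⟨k, hk⟩], by simp⟩
    | h₂ k j hk hj =>
      obtain ⟨L, hL⟩ := hk
      refine ⟨⟨j, hj⟩ :: (L ++ [⟨j, hj⟩]), ?_⟩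
      rw [← weylGroup.ofIdx_smul_idx, ← weylGroup.conj_ofIdx, hL,
        inv_eq_of_mul_eq_one_left (weylGroup.ofIdx_mul_self j)]
      simp [mul_assoc]
  obtain ⟨g, hg⟩ := g
  induction hg using weylGroup.induction with
  | mem i => exact key i
  | one => exact ⟨[], rfl⟩
  | mul x y hx hy ihx ihy =>
    obtain ⟨L, hL⟩ := ihx
    obtain ⟨L', hL'⟩ := ihy
    exact ⟨L ++ L', by rw [List.map_append, List.prod_append, ← hL, ← hL']; rfl⟩

variable [P.IsRootSystem]

omit [Finite ι] [P.IsCrystallographic] [P.IsReduced] in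
theorem Base.repr_root_of_eq_sum {k : ι} {f : ι → ℤ}
    (hf : P.root k = ∑ j ∈ b.support, f j • P.root j) (i : b.support) :
    b.toWeightBasis.repr (P.root k) i = f i := by
  have : P.root k = ∑ j : b.support, (f j : ℚ) • b.toWeightBasis j := by
    rw [hf, ← Finset.sum_coe_sort]
    simp [Int.cast_smul_eq_zsmul]
  rw [this, b.toWeightBasis.repr_sum_self]

omit [Finite ι] [P.IsCrystallographic] [P.IsReduced] in
theorem Base.height_eq_sum_repr (k : ι) :
    (b.height k : ℚ) = ∑ i, b.toWeightBasis.repr (P.root k) i := by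
  obtain ⟨f, -, -, hf⟩ := b.exists_root_eq_sum_int k
  rw [height_eq_sum hf, ← Finset.sum_coe_sort]
  simp [b.repr_root_of_eq_sum hf]

omit [Finite ι] [P.IsCrystallographic] [P.IsReduced] in
theorem Base.IsPos.repr_nonneg {b : P.Base} {k : ι} (hk : b.IsPos k) (i : b.support) :
    0 ≤ b.toWeightBasis.repr (P.root k) i := by
  obtain ⟨f, -, hf', hf⟩ := b.exists_root_eq_sum_int k
  rw [b.repr_root_of_eq_sum hf]
  rcases hf' with h | h
  · exact_mod_cast h.le i
  · rw [isPos_iff, height_eq_sum hf] at hk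
    exact absurd hk (not_lt.2 (Finset.sum_nonpos fun i _ => h.le i))

omit [Finite ι] [P.IsCrystallographic] [P.IsReduced] in
theorem Base.repr_nonpos_of_not_isPos {b : P.Base} {k : ι} (hk : ¬ b.IsPos k) (i : b.support) :
    b.toWeightBasis.repr (P.root k) i ≤ 0 := by
  let := P.indexNeg
  have := (show b.IsPos (-k) from (Base.IsPos.neg_iff_not b k).2 hk).repr_nonneg i
  simpa using this

omit [Finite ι] [P.IsCrystallographic] [P.IsReduced] in
theorem Base.isPos_of_repr_nonneg {b : P.Base} {k : ι}
    (hk : ∀ i, 0 ≤ b.toWeightBasis.repr (P.root k) i) : b.IsPos k := by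
  by_contra h
  refine P.ne_zero k (b.toWeightBasis.repr.injective (Finsupp.ext fun i => ?_))
  rw [map_zero]
  exact le_antisymm (repr_nonpos_of_not_isPos h i) (hk i)

omit [Finite ι] [P.IsReduced] [P.IsRootSystem] in
/-- A root of greatest height is dominant. -/
theorem Base.pairingIn_nonneg_of_height_max {η : ι} (hη : ∀ k, b.height k ≤ b.height η)
    {i : ι} (hi : i ∈ b.support) : 0 ≤ P.pairingIn ℤ η i := by
  by_contra! h
  have h1 := P.reflection_apply_root' ℤ (i := i) (j := η)
  rw [← root_reflectionPerm, sub_eq_add_neg, ← neg_smul] at h1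
  have h2 := hη (P.reflectionPerm i η)
  rw [b.height_add_zsmul h1, height_one_of_mem_support hi] at h2
  simp at h2
  omega

omit [Finite ι] [P.IsCrystallographic] [P.IsReduced] in
theorem Base.pairing_eq_sum_repr (k j : ι) :
    P.pairing k j = ∑ i : b.support, b.toWeightBasis.repr (P.root k) i * P.pairing i j := by
  conv_lhs => rw [← root_coroot'_eq_pairing, ← b.toWeightBasis.sum_repr (P.root k)]
  simp

omit [P.IsReduced] [P.IsRootSystem] in
-- Were `η` negative, the positive root `-η` would pair positively with some simple coroot.
theorem Base.isPos_of_dominant {η : ι} (hη : ∀ i ∈ b.support, 0 ≤ P.pairingIn ℤ η i) :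
    b.IsPos η := by
  let := P.indexNeg
  by_contra h
  obtain ⟨j, hj, hj'⟩ :=
    ((Base.IsPos.neg_iff_not b η).2 h : b.IsPos (-η)).exists_mem_support_pos_pairingIn
  rw [P.zero_lt_pairingIn_iff'] at hj'
  have := hη j hj
  simp at hj'
  omega

variable [P.IsIrreducible]

/-- A dominant root has full support. -/
theorem Base.repr_pos_of_dominant {η : ι}
    (hη : ∀ i ∈ b.support, 0 ≤ P.pairingIn ℤ η i) (i : b.support) :
    0 < b.toWeightBasis.repr (P.root η) i := by
  have hpos := b.isPos_of_dominant hη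
  set c := b.toWeightBasis.repr (P.root η) with hc
  -- The span of the simple roots occurring in `η` is stable under all simple reflections, so
  -- irreducibility makes it the whole space.
  let q : Submodule ℚ M := Submodule.span ℚ ((fun i : b.support => P.root i) '' {i | c i ≠ 0})
  have hq : ∀ j ∈ b.support, q ∈ Module.End.invtSubmodule (P.reflection j : M →ₗ[ℚ] M) := by
    intro j hj
    rw [Module.End.mem_invtSubmodule]
    intro x hx
    rw [Submodule.mem_comap, LinearEquiv.coe_coe, reflection_apply]
    by_cases hcj : c ⟨j, hj⟩ = 0
    · have hle : q ≤ LinearMap.ker (P.coroot' j) := by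
        refine Submodule.span_le.2 ?_
        rintro _ ⟨k, hk, rfl⟩
        -- For `α_j` not occurring in `η`, the number `⟨η, α_j^∨⟩ ≥ 0` is a sum of nonpositive
        -- terms. So every term vanishes, and `α_j^∨` kills `q`.
        have hterm : ∀ l : b.support, c l * P.pairing l j ≤ 0 := by
          intro l
          by_cases hl : (l : ι) = j
          · have : l = ⟨j, hj⟩ := Subtype.ext hl
            rw [this, hcj, zero_mul]
          · refine mul_nonpos_of_nonneg_of_nonpos (hpos.repr_nonneg l) ?_
            rw [← P.intCast_pairingIn]
            exact_mod_cast b.pairingIn_le_zero_of_ne hl l.2 hj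
        have hsum : 0 ≤ ∑ l, c l * P.pairing l j := by
          rw [hc, ← b.pairing_eq_sum_repr, ← P.intCast_pairingIn]
          exact_mod_cast hη j hj
        have h0 := (Finset.sum_eq_zero_iff_of_nonpos fun l _ => hterm l).1
          (le_antisymm (Finset.sum_nonpos fun l _ => hterm l) hsum) k (Finset.mem_univ _)
        simpa using (mul_eq_zero.1 h0).resolve_left hk
      rw [show P.coroot' j x = 0 from hle hx, zero_smul, sub_zero]
      exact hx
    · exact q.sub_mem hx (q.smul_mem _ (Submodule.subset_span ⟨⟨j, hj⟩, hcj, rfl⟩))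
  have hmem : P.root η ∈ q := by
    rw [← b.toWeightBasis.sum_repr (P.root η)]
    refine q.sum_mem fun k _ => ?_
    by_cases hk : c k = 0
    · rw [← hc, hk, zero_smul]; exact q.zero_mem
    · rw [b.toWeightBasis_apply]
      exact q.smul_mem _ (Submodule.subset_span ⟨k, hk, rfl⟩)
  have htop : q = ⊤ := IsIrreducible.eq_top_of_invtSubmodule_reflection (P := P) q
    ((b.forall_mem_support_invtSubmodule_iff q).1 hq)
    (fun h => P.ne_zero η (by simpa [h] using hmem))
  refine lt_of_le_of_ne (hpos.repr_nonneg i) fun h0 => ?_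
  have hle : q ≤ LinearMap.ker (b.toWeightBasis.coord i) := by
    refine Submodule.span_le.2 ?_
    rintro _ ⟨k, hk, rfl⟩
    have : k ≠ i := by rintro rfl; exact hk h0.symm
    simp [this]
  have : P.root i ∈ LinearMap.ker (b.toWeightBasis.coord i) := hle (htop ▸ Submodule.mem_top)
  simp at this

/-- The root of greatest height of an irreducible root system dominates every root. -/
theorem Base.repr_le_of_height_max {η : ι} (hη : ∀ k, b.height k ≤ b.height η) (k : ι)
    (i : b.support) :
    b.toWeightBasis.repr (P.root k) i ≤ b.toWeightBasis.repr (P.root η) i := by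
  let := P.indexNeg
  -- Choose `l` of greatest height among the roots above `k`. It is dominant, since otherwise a
  -- simple reflection would raise it within `T`. It turns out to be `η`.
  let T : Set ι := {l | ∀ i, b.toWeightBasis.repr (P.root k) i ≤ b.toWeightBasis.repr (P.root l) i}
  obtain ⟨l, hlT, hl⟩ := T.toFinite.exists_maximalFor b.height T ⟨k, fun i => le_rfl⟩
  replace hl : ∀ l' ∈ T, b.height l' ≤ b.height l := fun l' h => by
    by_contra! h'
    exact absurd (hl h h'.le) (not_le.2 h')
  have hldom : ∀ j ∈ b.support, 0 ≤ P.pairingIn ℤ l j := by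
    intro j hj
    by_contra! h
    have h1 := P.reflection_apply_root' ℤ (i := j) (j := l)
    rw [← root_reflectionPerm, sub_eq_add_neg, ← neg_smul] at h1
    have h2 := hl (P.reflectionPerm j l) fun i => (hlT i).trans (by
      rw [h1, map_add, Finsupp.add_apply, le_add_iff_nonneg_right, ← Int.cast_smul_eq_zsmul ℚ,
        map_smul, Finsupp.smul_apply, smul_eq_mul]
      refine mul_nonneg (by exact_mod_cast (neg_pos.2 h).le) ?_
      exact (isPos_of_mem_support hj).repr_nonneg i)
    rw [b.height_add_zsmul h1, height_one_of_mem_support hj] at h2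
    simp at h2
    omega
  have hηdom : ∀ j ∈ b.support, 0 ≤ P.pairingIn ℤ η j :=
    fun j hj => b.pairingIn_nonneg_of_height_max hη hj
  have hnn : ∀ i : b.support, 0 ≤ P.pairing i η := fun i => by
    have h := hηdom i i.2
    rw [← P.intCast_pairingIn]
    by_contra! h'
    have h'' : P.pairingIn ℤ i η < 0 := by exact_mod_cast h'
    rw [P.pairingIn_lt_zero_iff] at h''
    omega
  -- The coefficients of `l` are all positive and the `⟨α_i, η^∨⟩` are nonnegative, not all zero
  -- because `⟨η, η^∨⟩ = 2`.
  have hpair : 0 < P.pairingIn ℤ l η := by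
    have h2 : 0 < P.pairing l η := by
      rw [b.pairing_eq_sum_repr]
      refine Finset.sum_pos' (fun i _ => mul_nonneg (b.repr_pos_of_dominant hldom i).le (hnn i)) ?_
      by_contra! h
      have h3 : P.pairing η η ≤ 0 := by
        rw [b.pairing_eq_sum_repr]
        refine Finset.sum_nonpos fun i hi => mul_nonpos_of_nonneg_of_nonpos
          (b.repr_pos_of_dominant hηdom i).le ?_
        by_contra! h4
        exact absurd (h i hi) (not_le.2 (mul_pos (b.repr_pos_of_dominant hldom i) h4))
      rw [pairing_same] at h3
      norm_num at h3
    rw [← P.intCast_pairingIn] at h2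
    exact_mod_cast h2
  rcases eq_or_ne l η with rfl | hne
  · exact hlT i
  -- The root `l - η` is negative by the height bound, so `η` lies above `l` and belongs to `T`.
  -- Then `η` is no higher than `l`, and the root `l - η` would have height zero.
  obtain ⟨r, hr⟩ := P.root_sub_root_mem_of_pairingIn_pos hpair hne
  have hh := b.height_sub hr
  have h1 := hη l
  have hrneg : ¬ b.IsPos r := by rw [isPos_iff]; omega
  have h2 := hl η fun i => (hlT i).trans (by
    have := repr_nonpos_of_not_isPos hrneg i
    rw [hr, map_sub, Finsupp.sub_apply] at this
    linarith)
  rw [isPos_iff'] at hrneg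
  omega

theorem Base.eq_of_height_max {η η' : ι} (hη : ∀ k, b.height k ≤ b.height η)
    (hη' : ∀ k, b.height k ≤ b.height η') : η = η' := by
  refine P.root.injective (b.toWeightBasis.repr.injective (Finsupp.ext fun i => ?_))
  exact le_antisymm (b.repr_le_of_height_max hη' η i) (b.repr_le_of_height_max hη η' i)

/-- If `⟨k, η^∨⟩ ≥ 2`, comparing the height of the root `-s_η k = ⟨k, η^∨⟩ η - k` with that of `η`
forces `k` to be as high as `η`, hence equal to it. -/
theorem Base.pairingIn_le_one_of_height_max {η k : ι} (hη : ∀ k, b.height k ≤ b.height η)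
    (hk : k ≠ η) : P.pairingIn ℤ k η ≤ 1 := by
  let := P.indexNeg
  by_contra! h
  have h1 := P.reflection_apply_root' ℤ (i := η) (j := k)
  rw [← root_reflectionPerm, sub_eq_add_neg, ← neg_smul] at h1
  have h2 := hη (-(P.reflectionPerm η k))
  rw [b.height_reflectionPerm_self, b.height_add_zsmul h1, smul_eq_mul] at h2
  have h3 := hη k
  have h4 : 0 < b.height η :=
    b.isPos_of_dominant fun j hj => b.pairingIn_nonneg_of_height_max hη hj
  refine hk (b.eq_of_height_max (fun l => (hη l).trans ?_) hη)
  nlinarith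

end Base

end RootPairing

/-! ### The invariant pairing, and the transfer of dominance from coroots of `X` to roots of `Y`. -/

noncomputable section
namespace DoubleAffineDatum

variable {ιX ιY V V' U U' : Type*} [Fintype ιX] [Fintype ιY]
  [AddCommGroup V] [Module ℚ V] [AddCommGroup V'] [Module ℚ V']
  [AddCommGroup U] [Module ℚ U] [AddCommGroup U'] [Module ℚ U']
  (D : DoubleAffineDatum ιX ιY V V' U U')

open RootPairing

/-- The multiple of `δ` by which affine roots with finite part `β` are spaced: `1` in the untwisted
case, and the ratio of the square length of `β` to that of a short root in the dual untwisted
case. -/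
def spacing (k : ιY) : ℚ :=
  match D.kind with
  | .untwisted => 1
  | .dualUntwisted =>
    D.PY.RootForm (D.PY.root k) (D.PY.root k) /
      D.PY.RootForm (D.PY.root D.thetaIdx) (D.PY.root D.thetaIdx)

theorem gam_eq_spacing (i : D.I0) : D.gam i = D.spacing (D.node i) := rfl

theorem rootForm_root_pos (k : ιY) : 0 < D.PY.RootForm (D.PY.root k) (D.PY.root k) := by
  obtain ⟨s, hs, hs'⟩ := (D.PY.posRootForm ℚ).exists_pos_eq k
  exact lt_of_lt_of_eq hs hs'

theorem spacing_pos (k : ιY) : 0 < D.spacing k := by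
  unfold spacing
  split
  · exact one_pos
  · exact div_pos (D.rootForm_root_pos k) (D.rootForm_root_pos _)

theorem spacing_smul (g : D.PY.weylGroup) (k : ιY) : D.spacing (g • k) = D.spacing k := by
  unfold spacing
  split
  · rfl
  · rw [← weylGroup_smul_root]
    congr 1
    exact InvariantForm.apply_weylGroup_smul D.PY (B := (D.PY.posRootForm ℚ).toInvariantForm) g _ _

theorem spacing_theta : D.spacing D.thetaIdx = 1 := by
  unfold spacing
  split
  · rfl
  · exact div_self (D.rootForm_root_pos _).ne'

/-- The `γ_i` symmetrize the Cartan data, so that the pairing has the same shape when a simple root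
is put in either argument. Invariance under `W₀` depends on this. -/
theorem spacing_mul_pairing (i j : D.I0) :
    D.gam j * D.PX.pairing i j = D.gam i * D.PY.pairing (D.node j) (D.node i) := by
  have hc := D.cartan
  unfold gam
  split <;> rename_i h <;> rw [h] at hc
  · rw [hc]
  · have h1 := (D.PY.posRootForm ℚ).toInvariantForm.pairing_mul_eq_pairing_mul_swap
      (D.node i) (D.node j)
    change _ * D.PY.RootForm _ _ = _ * D.PY.RootForm _ _ at h1
    rw [← hc i j, div_mul_eq_mul_div, div_mul_eq_mul_div, mul_comm, ← h1, mul_comm]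

/-! ### The pairing -/

theorem latticePairing_simple (x : V) (i : D.I0) :
    D.latticePairing x (D.PY.root (D.node i)) = D.gam i * D.PX.coroot' i x := by
  classical
  simp only [latticePairing, LinearMap.sum_apply, LinearMap.smul_apply, LinearMap.smulRight_apply,
    Module.Basis.coord_apply, Base.toWeightBasis_repr_root]
  rw [Finset.sum_eq_single i]
  · simp
  · intro j _ hj
    have : D.node i ≠ D.node j := fun h => hj (D.node.injective h).symm
    simp [this]
  · simp

theorem ext_simple {f g : U →ₗ[ℚ] ℚ}
    (h : ∀ i, f (D.PY.root (D.node i)) = g (D.PY.root (D.node i))) : f = g :=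
  D.baseY.toWeightBasis.ext fun i => by
    obtain ⟨i, rfl⟩ := D.node.surjective i
    simpa using h i

theorem latticePairing_root_simple (i : D.I0) (y : U) :
    D.latticePairing (D.PX.root i) y = D.gam i * D.PY.coroot' (D.node i) y := by
  suffices h : D.latticePairing (D.PX.root i) = D.gam i • D.PY.coroot' (D.node i) by
    rw [h]; rfl
  refine D.ext_simple fun j => ?_
  rw [latticePairing_simple, LinearMap.smul_apply, root_coroot'_eq_pairing, root_coroot'_eq_pairing,
    smul_eq_mul, spacing_mul_pairing]

theorem latticePairing_smul (w : D.W0) (x : V) (y : U) :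
    D.latticePairing (w • x) (D.actY w y) = D.latticePairing x y := by
  obtain ⟨L, rfl⟩ := D.baseX.exists_word w
  induction L generalizing x y with
  | nil => simp [actY]
  | cons i L ih =>
    rw [List.map_cons, List.prod_cons, mul_smul, actY, map_mul, mul_smul]
    refine Eq.trans ?_ (ih x y)
    generalize (L.map fun i : D.baseX.support => weylGroup.ofIdx D.PX i).prod = w
    change _ = D.latticePairing (w • x) (D.weylIso w • y)
    generalize w • x = x, D.weylIso w • y = y
    rw [D.weylIso_simple, weylGroup.ofIdx_smul_eq, weylGroup.ofIdx_smul_eq]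
    simp only [map_sub, map_smul, LinearMap.sub_apply, LinearMap.smul_apply, smul_eq_mul,
      latticePairing_simple, latticePairing_root_simple, root_coroot'_eq_pairing, pairing_same]
    ring

/-- Such a vector is fixed by the simple reflections, hence by every reflection, so all coroots
vanish on it. This makes the action of `W(Ỹ)` faithful. -/
theorem eq_zero_of_latticePairing_eq_zero {x : V} (hx : ∀ y, D.latticePairing x y = 0) :
    x = 0 := by
  have hfix : ∀ w : D.W0, w • x = x := by
    intro w
    obtain ⟨L, rfl⟩ := D.baseX.exists_word w
    induction L with
    | nil => simp
    | cons i L ih =>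
      have h1 := hx (D.PY.root (D.node i))
      rw [latticePairing_simple] at h1
      rw [List.map_cons, List.prod_cons, mul_smul, ih, weylGroup.ofIdx_smul_eq,
        (mul_eq_zero.1 h1).resolve_left (D.spacing_pos _).ne', zero_smul, sub_zero]
  refine D.PX.eq_zero_iff_forall_coroot'_eq_zero.2 fun k => ?_
  have h1 := hfix (weylGroup.ofIdx D.PX k)
  rw [weylGroup.ofIdx_smul_eq, sub_eq_self] at h1
  exact (smul_eq_zero.1 h1).resolve_right (D.PX.ne_zero k)

/-! ### Corresponding roots of `X` and `Y` -/

/-- The roots `w α_i` of `X` and `Y` correspond, for `w ∈ W₀` and `i ∈ I₀`. -/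
def Corresponds (k : ιX) (l : ιY) : Prop :=
  ∃ (w : D.W0) (i : D.I0), k = w • (i : ιX) ∧ l = D.weylIso w • (D.node i : ιY)

theorem exists_corresponds_left (k : ιX) : ∃ l, D.Corresponds k l := by
  obtain ⟨w, i, rfl⟩ := D.baseX.exists_eq_smul_simple k
  exact ⟨_, w, i, rfl, rfl⟩

theorem exists_corresponds_right (l : ιY) : ∃ k, D.Corresponds k l := by
  obtain ⟨w, i, rfl⟩ := D.baseY.exists_eq_smul_simple l
  obtain ⟨w, rfl⟩ := D.weylIso.surjective w
  obtain ⟨i, rfl⟩ := D.node.surjective i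
  exact ⟨_, w, i, rfl, rfl⟩

variable {D}

theorem Corresponds.latticePairing_left {k : ιX} {l : ιY} (h : D.Corresponds k l) (y : U) :
    D.latticePairing (D.PX.root k) y = D.spacing l * D.PY.coroot' l y := by
  obtain ⟨w, i, rfl, rfl⟩ := h
  obtain ⟨y, rfl⟩ := MulAction.surjective (D.weylIso w) y
  rw [← weylGroup_smul_root, coroot'_weylGroup_smul, spacing_smul]
  exact (D.latticePairing_smul w _ _).trans (D.latticePairing_root_simple i y)

theorem Corresponds.latticePairing_right {k : ιX} {l : ιY} (h : D.Corresponds k l) (x : V) :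
    D.latticePairing x (D.PY.root l) = D.spacing l * D.PX.coroot' k x := by
  obtain ⟨w, i, rfl, rfl⟩ := h
  obtain ⟨x, rfl⟩ := MulAction.surjective w x
  rw [← weylGroup_smul_root, coroot'_weylGroup_smul, spacing_smul]
  exact (D.latticePairing_smul w _ _).trans (D.latticePairing_simple x i)

theorem Corresponds.weylIso_ofIdx {k : ιX} {l : ιY} (h : D.Corresponds k l) :
    D.weylIso (weylGroup.ofIdx D.PX k) = weylGroup.ofIdx D.PY l := by
  obtain ⟨w, i, rfl, rfl⟩ := h
  rw [← weylGroup.conj_ofIdx, ← weylGroup.conj_ofIdx, map_mul, map_mul, map_inv, D.weylIso_simple]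

/-- Expand `(x, β)` once through the simple roots of `Y` and once as a multiple of a coroot of `X`.
Up to the factors `γ_i` and `c_β`, roots of `Y` are coroots of `X`, in both types at once. -/
theorem Corresponds.repr_eq {k : ιX} {l : ιY} (h : D.Corresponds k l) (i : D.I0) :
    D.baseY.toWeightBasis.repr (D.PY.root l) (D.node i) * D.gam i =
      D.spacing l * D.baseX.toCoweightBasis.repr (D.PX.coroot k) i := by
  have hv : ∑ i, (D.baseY.toWeightBasis.repr (D.PY.root l) (D.node i) * D.gam i) •
      D.baseX.toCoweightBasis i = D.spacing l • D.PX.coroot k := by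
    refine D.PX.flip.toPerfPair.injective (LinearMap.ext fun x => ?_)
    have h1 := h.latticePairing_right x
    rw [← D.baseY.toWeightBasis.sum_repr (D.PY.root l), map_sum, ← D.node.sum_comp] at h1
    simp only [map_smul, Base.toWeightBasis_apply, latticePairing_simple] at h1
    rw [map_sum, LinearMap.sum_apply, map_smul]
    simp only [map_smul, LinearMap.smul_apply, Base.toCoweightBasis_apply]
    refine Eq.trans ?_ h1
    refine Finset.sum_congr rfl fun i _ => ?_
    rw [smul_eq_mul, smul_eq_mul, mul_assoc]
    rfl
  have := congrArg (fun v => D.baseX.toCoweightBasis.repr v i) hv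
  simpa only [Module.Basis.repr_sum_self, map_smul, Finsupp.smul_apply, smul_eq_mul] using this

variable (D)

theorem rootForm_mul_repr_coroot (l : ιY) (i : D.baseY.support) :
    D.PY.RootForm (D.PY.root l) (D.PY.root l) *
      D.baseY.toCoweightBasis.repr (D.PY.coroot l) i =
    D.baseY.toWeightBasis.repr (D.PY.root l) i *
      D.PY.RootForm (D.PY.root i) (D.PY.root i) := by
  have h1 : D.PY.RootForm (D.PY.root l) (D.PY.root l) • D.PY.coroot l =
      ∑ i, (D.baseY.toWeightBasis.repr (D.PY.root l) i *
        D.PY.RootForm (D.PY.root i) (D.PY.root i)) • D.baseY.toCoweightBasis i := by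
    rw [rootForm_self_smul_coroot]
    conv_lhs => rw [← D.baseY.toWeightBasis.sum_repr (D.PY.root l)]
    rw [map_sum, Finset.smul_sum]
    refine Finset.sum_congr rfl fun i _ => ?_
    rw [map_smul, smul_comm, Base.toWeightBasis_apply, ← rootForm_self_smul_coroot, smul_smul,
      Base.toCoweightBasis_apply]
  have := congrArg (fun v => D.baseY.toCoweightBasis.repr v i) h1
  simpa only [Module.Basis.repr_sum_self, map_smul, Finsupp.smul_apply, smul_eq_mul] using this

theorem height_le_vartheta (k : ιX) :
    D.baseX.flip.height k ≤ D.baseX.flip.height D.varthetaIdx :=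
  have := D.nonempty_X
  (Finite.exists_max D.baseX.flip.height).choose_spec k

/-- The height of a coroot of `X` equals that of the corresponding root of `Y` (untwisted) or coroot
of `Y` (dual untwisted). So a partner of `ϑ` maximizes the function that defines `θ`, and the
maximizer is unique. -/
theorem corresponds_vartheta_theta : D.Corresponds D.varthetaIdx D.thetaIdx := by
  have := D.nonempty_Y
  obtain ⟨l, hl⟩ := D.exists_corresponds_left D.varthetaIdx
  suffices h : l = D.thetaIdx by rwa [← h]
  have hX (k : ιX) : (D.baseX.flip.height k : ℚ) =
      ∑ i, D.baseX.toCoweightBasis.repr (D.PX.coroot k) i := D.baseX.flip.height_eq_sum_repr k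
  have hflip (k : ιY) : (D.baseY.flip.height k : ℚ) =
      ∑ i, D.baseY.toCoweightBasis.repr (D.PY.coroot k) i := D.baseY.flip.height_eq_sum_repr k
  rcases hkind : D.kind with _ | _
  · have hht {k l} (h : D.Corresponds k l) : D.baseX.flip.height k = D.baseY.height l := by
      rw [← Int.cast_inj (α := ℚ), hX, Base.height_eq_sum_repr, ← D.node.sum_comp]
      refine Finset.sum_congr rfl fun i _ => ?_
      have := h.repr_eq i
      simp only [gam, spacing, hkind, mul_one, one_mul] at this
      exact this.symm
    refine D.baseY.eq_of_height_max (fun l' => ?_) fun l' => ?_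
    · obtain ⟨k', hk'⟩ := D.exists_corresponds_right l'
      rw [← hht hl, ← hht hk']
      exact D.height_le_vartheta k'
    · simp only [thetaIdx, hkind]
      exact (Finite.exists_max D.baseY.height).choose_spec l'
  · have hht {k l} (h : D.Corresponds k l) : D.baseX.flip.height k = D.baseY.flip.height l := by
      rw [← Int.cast_inj (α := ℚ), hX, hflip, ← D.node.sum_comp]
      refine Finset.sum_congr rfl fun i _ => ?_
      have h1 := h.repr_eq i
      have h2 := D.rootForm_mul_repr_coroot l (D.node i)
      have h3 := (D.rootForm_root_pos l).ne'
      have h4 := (D.rootForm_root_pos D.thetaIdx).ne'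
      simp only [gam, spacing, hkind, ← mul_div_assoc, ← h2] at h1
      rw [div_mul_eq_mul_div, div_left_inj' h4] at h1
      exact (mul_left_cancel₀ h3 h1).symm
    refine D.baseY.flip.eq_of_height_max (fun l' => ?_) fun l' => ?_
    · obtain ⟨k', hk'⟩ := D.exists_corresponds_right l'
      rw [← hht hl, ← hht hk']
      exact D.height_le_vartheta k'
    · simp only [thetaIdx, hkind]
      exact (Finite.exists_max D.baseY.flip.height).choose_spec l'

/-- `c_β θ` dominates the root `β` of `Y`. -/
theorem repr_root_le (l : ιY) (i : D.baseY.support) :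
    D.baseY.toWeightBasis.repr (D.PY.root l) i ≤
      D.spacing l * D.baseY.toWeightBasis.repr (D.PY.root D.thetaIdx) i := by
  obtain ⟨i, rfl⟩ := D.node.surjective i
  obtain ⟨k, hk⟩ := D.exists_corresponds_right l
  have h1 := hk.repr_eq i
  have h2 := D.corresponds_vartheta_theta.repr_eq i
  rw [spacing_theta, one_mul] at h2
  have h3 : D.baseX.toCoweightBasis.repr (D.PX.coroot k) i ≤
      D.baseX.toCoweightBasis.repr (D.PX.coroot D.varthetaIdx) i :=
    D.baseX.flip.repr_le_of_height_max D.height_le_vartheta k i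
  -- After multiplication by `γ_i` the claim is that the highest coroot of `X` dominates the coroot
  -- of `k`.
  refine le_of_mul_le_mul_right ?_ (D.spacing_pos (D.node i))
  rw [← gam_eq_spacing, h1, mul_assoc, h2]
  exact mul_le_mul_of_nonneg_left h3 (D.spacing_pos l).le

theorem isPos_theta : D.baseY.IsPos D.thetaIdx := by
  refine Base.isPos_of_repr_nonneg fun i => ?_
  have h1 := D.repr_root_le D.thetaIdx i
  -- The root `-θ` also has spacing 1, so `θ` dominates `-θ`: its coefficients are nonnegative.
  have h2 := D.repr_root_le (weylGroup.ofIdx D.PY D.thetaIdx • D.thetaIdx) i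
  rw [spacing_smul, ← weylGroup_smul_root, weylGroup.ofIdx_smul_eq, root_coroot'_eq_pairing,
    pairing_same, spacing_theta, two_smul] at h2
  simp at h2
  linarith

/-- In the dual untwisted case pass to a root `k` of the same length that is not orthogonal to `θ`.
Unless `k = ±θ`, one has `⟨θ, k^∨⟩ = ±1` because `θ^∨` is the highest coroot, and `c_k ⟨θ, k^∨⟩ =
⟨k, θ^∨⟩` is an integer. The signs of folds require integral multiples of `δ`. -/
theorem spacing_int (l : ιY) : ∃ n : ℤ, D.spacing l = n := by
  rcases hkind : D.kind with _ | _
  · exact ⟨1, by simp [spacing, hkind]⟩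
  let := D.PY.indexNeg
  have hs (l) : D.spacing l = D.PY.RootForm (D.PY.root l) (D.PY.root l) /
      D.PY.RootForm (D.PY.root D.thetaIdx) (D.PY.root D.thetaIdx) := by simp [spacing, hkind]
  have hmax (k : ιY) : D.baseY.flip.height k ≤ D.baseY.flip.height D.thetaIdx := by
    have := D.nonempty_Y
    simp only [thetaIdx, hkind]
    exact (Finite.exists_max D.baseY.flip.height).choose_spec k
  obtain ⟨k, hk, hk'⟩ := D.PY.exists_form_eq_form_and_form_ne_zero
    (D.PY.posRootForm ℚ).toInvariantForm D.thetaIdx l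
  change D.PY.RootForm _ _ = D.PY.RootForm _ _ at hk
  replace hk' : D.PY.pairing D.thetaIdx k ≠ 0 := fun h =>
    hk' ((InvariantForm.apply_root_root_zero_iff _ _ _).2 h)
  have hsk : D.spacing l = D.spacing k := by rw [hs, hs, hk]
  have hneg : D.spacing (-k) = D.spacing k := by rw [hs, hs]; simp
  rw [hsk]
  by_cases h1 : k = D.thetaIdx
  · exact ⟨1, by rw [h1, spacing_theta, Int.cast_one]⟩
  by_cases h2 : -k = D.thetaIdx
  · exact ⟨1, by rw [← hneg, h2, spacing_theta, Int.cast_one]⟩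
  have h3 : D.PY.pairingIn ℤ D.thetaIdx k ≤ 1 :=
    D.baseY.flip.pairingIn_le_one_of_height_max hmax h1
  have h4 : D.PY.pairingIn ℤ D.thetaIdx (-k) ≤ 1 :=
    D.baseY.flip.pairingIn_le_one_of_height_max hmax h2
  simp only [indexNeg_neg, pairingIn_reflectionPerm_self_right] at h4
  have h5 := (D.PY.posRootForm ℚ).toInvariantForm.pairing_mul_eq_pairing_mul_swap k D.thetaIdx
  change _ * D.PY.RootForm _ _ = _ * D.PY.RootForm _ _ at h5
  have h6 : D.spacing k * D.PY.pairing D.thetaIdx k = D.PY.pairing k D.thetaIdx := by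
    rw [hs, div_mul_eq_mul_div, mul_comm, h5, mul_div_assoc,
      div_self (D.rootForm_root_pos _).ne', mul_one]
  rw [← intCast_pairingIn, ← intCast_pairingIn] at h6
  rw [← intCast_pairingIn, Int.cast_ne_zero] at hk'
  rcases (show D.PY.pairingIn ℤ D.thetaIdx k = 1 ∨ D.PY.pairingIn ℤ D.thetaIdx k = -1 by
    omega) with h | h
  · exact ⟨_, by rw [← h6, h, Int.cast_one, mul_one]⟩
  · exact ⟨-_, by rw [Int.cast_neg, ← h6, h]; simp⟩

end DoubleAffineDatum
end

/-! ### The affine root system and the exchange condition. -/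

noncomputable section
namespace DoubleAffineDatum

variable {ιX ιY V V' U U' : Type*} [Fintype ιX] [Fintype ιY]
  [AddCommGroup V] [Module ℚ V] [AddCommGroup V'] [Module ℚ V']
  [AddCommGroup U] [Module ℚ U] [AddCommGroup U'] [Module ℚ U']
  (D : DoubleAffineDatum ιX ιY V V' U U')

open RootPairing

/-! ### The affine action -/

variable {D}

theorem dir_mul (w w' : D.W) : dir (w * w') = dir w * dir w' := rfl

theorem wt_mul (w w' : D.W) : (wt (w * w') : V) = wt w + dir w • (wt w' : V) := rfl

theorem affAct_one (y : U × ℚ) : affAct (1 : D.W) y = y := by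
  have h : wt (1 : D.W) = 0 := rfl
  have h' : dir (1 : D.W) = 1 := rfl
  simp [affAct, actY, h, h']

theorem affAct_mul (w w' : D.W) (y : U × ℚ) : affAct (w * w') y = affAct w (affAct w' y) := by
  have h : D.actY (dir w * dir w') y.1 = D.actY (dir w) (D.actY (dir w') y.1) := by
    simp [actY, mul_smul]
  ext
  · exact h
  · change y.2 - D.latticePairing (wt (w * w') : V) (D.actY (dir w * dir w') y.1) =
      y.2 - D.latticePairing (wt w' : V) (D.actY (dir w') y.1) -
        D.latticePairing (wt w : V) (D.actY (dir w) (D.actY (dir w') y.1))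
    rw [h, wt_mul, map_add, LinearMap.add_apply, latticePairing_smul]
    ring

/-- The action of an element of `W(Ỹ)` on `Ỹ_ℚ` as a linear map. -/
def affLin (w : D.W) : U × ℚ →ₗ[ℚ] U × ℚ where
  toFun := affAct w
  map_add' y z := by
    ext
    · exact smul_add _ _ _
    · simp only [affAct, actY, Prod.fst_add, Prod.snd_add, smul_add, map_add]
      ring
  map_smul' a y := by
    ext
    · exact smul_comm _ _ _
    · simp only [affAct, actY, Prod.smul_fst, Prod.smul_snd, smul_comm _ a, map_smul, smul_eq_mul,
        RingHom.id_apply]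
      ring

theorem affLin_apply (w : D.W) (y : U × ℚ) : affLin w y = affAct w y := rfl

theorem affAct_neg (w : D.W) (y : U × ℚ) : affAct w (-y) = -affAct w y := map_neg (affLin w) y

theorem affAct_inv_affAct (w : D.W) (y : U × ℚ) : affAct w⁻¹ (affAct w y) = y := by
  rw [← affAct_mul, inv_mul_cancel, affAct_one]

theorem affAct_affAct_inv (w : D.W) (y : U × ℚ) : affAct w (affAct w⁻¹ y) = y := by
  rw [← affAct_mul, mul_inv_cancel, affAct_one]

theorem affAct_delta (w : D.W) (a : ℚ) : affAct w (0, a) = (0, a) := by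
  simp [affAct, actY]

/-- Faithfulness is what allows a reflection to be identified by its affine root. -/
theorem eq_of_affAct_eq {w w' : D.W} (h : ∀ y, affAct w y = affAct w' y) : w = w' := by
  have hd : dir w = dir w' := D.weylIso.injective
    (weylGroup_ext fun y => congrArg Prod.fst (h (y, 0)))
  have hw : (wt w : V) = wt w' := by
    rw [← sub_eq_zero]
    refine D.eq_zero_of_latticePairing_eq_zero fun y => ?_
    obtain ⟨y, rfl⟩ := MulAction.surjective (D.weylIso (dir w)) y
    have h1 := congrArg Prod.snd (h (y, 0))
    simp only [affAct, ← hd, zero_sub, neg_inj] at h1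
    rw [map_sub, LinearMap.sub_apply, sub_eq_zero]
    exact h1
  exact SemidirectProduct.ext (Subtype.ext hw) hd

/-! ### Real affine roots -/

variable (D) in
/-- The real affine roots, in `Ỹ_ℚ`. -/
def IsAffRoot (β : U × ℚ) : Prop :=
  ∃ (k : ιY) (n : ℤ), β = (D.PY.root k, D.spacing k * n)

theorem IsAffRoot.neg {β : U × ℚ} (h : D.IsAffRoot β) : D.IsAffRoot (-β) := by
  obtain ⟨k, n, rfl⟩ := h
  refine ⟨weylGroup.ofIdx D.PY k • k, -n, ?_⟩
  rw [spacing_smul, ← weylGroup_smul_root, weylGroup.ofIdx_smul_eq, root_coroot'_eq_pairing,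
    pairing_same, two_smul]
  ext
  · simp
  · simp

theorem IsAffRoot.ne_zero {β : U × ℚ} (h : D.IsAffRoot β) : β ≠ 0 := by
  obtain ⟨k, n, rfl⟩ := h
  exact fun h => D.PY.ne_zero k (congrArg Prod.fst h)

/-- A translation shifts a root `β` by `(x, β) δ` up to sign, and this is `c_β` times the integral
value of a coroot at `x`. -/
theorem IsAffRoot.affAct {β : U × ℚ} (h : D.IsAffRoot β) (w : D.W) :
    D.IsAffRoot (affAct w β) := by
  obtain ⟨k, n, rfl⟩ := h
  obtain ⟨l, hl⟩ := D.exists_corresponds_right (D.weylIso (dir w) • k)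
  obtain ⟨m, hm⟩ := D.X_le_weights _ (wt w).2 l
  refine ⟨D.weylIso (dir w) • k, n - m, ?_⟩
  ext
  · exact weylGroup_smul_root _ _
  · change _ - D.latticePairing _ (D.weylIso (dir w) • D.PY.root k) = _
    rw [weylGroup_smul_root, hl.latticePairing_right, hm, spacing_smul]
    push_cast
    ring

variable (D) in
theorem isAffRoot_simple (i : D.I) : D.IsAffRoot (D.affSimpleRoot i) := by
  cases i with
  | some i => exact ⟨D.node i, 0, by simp [affSimpleRoot]⟩
  | none =>
    have h : D.IsAffRoot (D.PY.root D.thetaIdx, -1) :=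
      ⟨D.thetaIdx, -1, by simp [spacing_theta]⟩
    simpa [affSimpleRoot] using h.neg

theorem isAffRoot_finite (k : ιY) : D.IsAffRoot (D.PY.root k, 0) := ⟨k, 0, by simp⟩

variable (D) in
/-- The coordinates with respect to the basis of simple affine roots. -/
def affCoord : D.I → U × ℚ →ₗ[ℚ] ℚ
  | some i => D.baseY.toWeightBasis.coord (D.node i) ∘ₗ
      (LinearMap.fst ℚ U ℚ + (LinearMap.snd ℚ U ℚ).smulRight (D.PY.root D.thetaIdx))
  | none => LinearMap.snd ℚ U ℚ

theorem affCoord_some (i : D.I0) (y : U × ℚ) :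
    D.affCoord (some i) y = D.baseY.toWeightBasis.repr y.1 (D.node i) +
      y.2 * D.baseY.toWeightBasis.repr (D.PY.root D.thetaIdx) (D.node i) := by
  simp [affCoord]

theorem affCoord_none (y : U × ℚ) : D.affCoord none y = y.2 := rfl

theorem affCoord_simple_of_ne {i j : D.I} (h : i ≠ j) :
    D.affCoord j (D.affSimpleRoot i) = 0 := by
  rcases i with _ | i <;> rcases j with _ | j
  · exact absurd rfl h
  · simp [affCoord_some, affSimpleRoot]
  · rfl
  · have : D.node i ≠ D.node j := fun h' => h (congrArg some (D.node.injective h'))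
    simp [affCoord_some, affSimpleRoot, this]

/-- Since `δ = α₀ + θ`, one has `y + a δ = (y + a θ) + a α₀`. -/
theorem sum_affCoord (y : U × ℚ) : ∑ i, D.affCoord i y • D.affSimpleRoot i = y := by
  rw [Fintype.sum_option]
  have h (z : U) : ∑ i, D.baseY.toWeightBasis.repr z (D.node i) • D.PY.root (D.node i) = z := by
    conv_rhs => rw [← D.baseY.toWeightBasis.sum_repr z, ← D.node.sum_comp]
    simp
  ext
  · simp only [affCoord_some, affSimpleRoot, Prod.fst_add, Prod.fst_sum, Prod.smul_fst, add_smul,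
      Finset.sum_add_distrib, h, mul_smul, ← Finset.smul_sum, affCoord_none]
    module
  · simp [affSimpleRoot, Prod.snd_sum, affCoord_none]

variable (D) in
/-- The cone spanned by the simple affine roots. -/
def AffPos (y : U × ℚ) : Prop := ∀ i, 0 ≤ D.affCoord i y

theorem eq_zero_of_affPos_neg {y : U × ℚ} (h : D.AffPos y) (h' : D.AffPos (-y)) : y = 0 := by
  rw [← sum_affCoord (D := D) y]
  refine Finset.sum_eq_zero fun i _ => ?_
  have := h' i
  rw [map_neg, neg_nonneg] at this
  rw [le_antisymm this (h i), zero_smul]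

variable (D) in
theorem affPos_simple (i : D.I) : D.AffPos (D.affSimpleRoot i) := by
  intro j
  by_cases h : i = j
  · subst h
    rcases i with _ | i
    · exact zero_le_one
    · simp [affCoord_some, affSimpleRoot]
  · exact (affCoord_simple_of_ne h).ge

theorem AffPos.sum {α : Type*} {s : Finset α} {f : α → U × ℚ} (h : ∀ a ∈ s, D.AffPos (f a)) :
    D.AffPos (∑ a ∈ s, f a) := fun i => by
  rw [map_sum]
  exact Finset.sum_nonneg fun a ha => h a ha i

theorem AffPos.smul {y : U × ℚ} (h : D.AffPos y) {a : ℚ} (ha : 0 ≤ a) : D.AffPos (a • y) :=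
  fun i => by
    rw [map_smul]
    exact mul_nonneg ha (h i)

theorem affPos_delta {a : ℚ} (ha : 0 ≤ a) : D.AffPos (0, a) := by
  rintro (_ | i)
  · exact ha
  · rw [affCoord_some]
    simpa using mul_nonneg ha (D.isPos_theta.repr_nonneg (D.node i))

theorem affPos_finite_iff {k : ιY} : D.AffPos (D.PY.root k, 0) ↔ D.baseY.IsPos k := by
  constructor
  · refine fun h => Base.isPos_of_repr_nonneg fun i => ?_
    obtain ⟨i, rfl⟩ := D.node.surjective i
    simpa [affCoord_some] using h (some i)
  · rintro h (_ | i)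
    · exact le_rfl
    · simpa [affCoord_some] using h.repr_nonneg (D.node i)

/-- For `n ≥ 1` the finite coordinates of `β + n c_β δ` are those of `β + n c_β θ`, nonnegative
because `c_β θ` dominates `-β`. Negation reduces `n < 0` to this, and `n = 0` concerns finite roots.
-/
theorem IsAffRoot.affPos_or {β : U × ℚ} (h : D.IsAffRoot β) : D.AffPos β ∨ D.AffPos (-β) := by
  have key (k : ιY) (n : ℤ) (hn : 0 < n) : D.AffPos (D.PY.root k, D.spacing k * n) := by
    have hn' : (1 : ℚ) ≤ n := by exact_mod_cast hn
    have hc := D.spacing_pos k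
    rintro (_ | i)
    · exact mul_nonneg hc.le (by linarith)
    · rw [affCoord_some]
      have h1 := D.repr_root_le (weylGroup.ofIdx D.PY k • k) (D.node i)
      have h2 := D.isPos_theta.repr_nonneg (D.node i)
      rw [spacing_smul, ← weylGroup_smul_root, weylGroup.ofIdx_smul_eq, root_coroot'_eq_pairing,
        pairing_same, two_smul, sub_add_cancel_left, map_neg, Finsupp.neg_apply] at h1
      have h3 := mul_le_mul_of_nonneg_right hn' (mul_nonneg hc.le h2)
      dsimp only
      nlinarith
  obtain ⟨k, n, rfl⟩ := id h
  rcases lt_trichotomy n 0 with hn | rfl | hn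
  · obtain ⟨k', n', hk'⟩ := h.neg
    right
    rw [hk']
    refine key k' n' ?_
    have h1 : -(D.spacing k * n) = D.spacing k' * n' := congrArg Prod.snd hk'
    have h2 : (n : ℚ) < 0 := by exact_mod_cast hn
    have h3 := mul_pos (D.spacing_pos k) (neg_pos.2 h2)
    have h4 : (0 : ℚ) < n' := by
      refine pos_of_mul_pos_right (a := D.spacing k') ?_ (D.spacing_pos k').le
      linarith
    exact_mod_cast h4
  · obtain ⟨k', n', hk'⟩ := h.neg
    have h1 : -(D.PY.root k) = D.PY.root k' := congrArg Prod.fst hk'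
    have h2 : (-(D.PY.root k, D.spacing k * ((0 : ℤ) : ℚ)) : U × ℚ) = (D.PY.root k', 0) := by
      ext
      · exact h1
      · simp
    rw [h2, Int.cast_zero, mul_zero, affPos_finite_iff, affPos_finite_iff]
    by_cases hk : D.baseY.IsPos k
    · exact Or.inl hk
    · refine Or.inr (Base.isPos_of_repr_nonneg fun i => ?_)
      rw [← h1, map_neg, Finsupp.neg_apply, neg_nonneg]
      exact Base.repr_nonpos_of_not_isPos hk i
  · exact Or.inl (key k n hn)

theorem IsAffRoot.not_affPos_neg {β : U × ℚ} (h : D.IsAffRoot β) (hβ : D.AffPos β) :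
    ¬ D.AffPos (-β) := fun h' => h.ne_zero (eq_zero_of_affPos_neg hβ h')

theorem affPos_affAct_of_mem_PiY {p : D.W} (hp : p ∈ D.PiY) {y : U × ℚ} (hy : D.AffPos y) :
    D.AffPos (affAct p y) := by
  rw [← affLin_apply, ← sum_affCoord (D := D) y, map_sum]
  refine AffPos.sum fun i _ => ?_
  rw [map_smul]
  refine AffPos.smul ?_ (hy i)
  have h : affAct p (D.affSimpleRoot i) ∈ Set.range D.affSimpleRoot :=
    hp.subset ⟨_, ⟨i, rfl⟩, rfl⟩
  obtain ⟨j, hj⟩ := h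
  rw [affLin_apply, ← hj]
  exact D.affPos_simple j

/-! ### Affine reflections -/

/-- `r` acts as the reflection in the affine root `β`. -/
def IsAffReflection (r : D.W) (β : U × ℚ) : Prop :=
  ∃ k, β.1 = D.PY.root k ∧ ∀ y, affAct r y = y - D.PY.coroot' k y.1 • β

theorem IsAffReflection.eq {r r' : D.W} {β : U × ℚ} (h : IsAffReflection r β)
    (h' : IsAffReflection r' β) : r = r' := by
  obtain ⟨k, hk, h⟩ := h
  obtain ⟨k', hk', h'⟩ := h'
  obtain rfl := D.PY.root.injective (hk.symm.trans hk')
  exact eq_of_affAct_eq fun y => (h y).trans (h' y).symm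

theorem IsAffReflection.conj {r : D.W} {β : U × ℚ} (h : IsAffReflection r β) (g : D.W) :
    IsAffReflection (g * r * g⁻¹) (affAct g β) := by
  obtain ⟨k, hk, h⟩ := h
  refine ⟨D.weylIso (dir g) • k, ?_, fun y => ?_⟩
  · rw [← weylGroup_smul_root, ← hk]; rfl
  · obtain ⟨y, rfl⟩ : ∃ y', affAct g y' = y := ⟨_, affAct_affAct_inv g y⟩
    rw [affAct_mul, affAct_inv_affAct, affAct_mul, h, ← affLin_apply, map_sub, map_smul]
    congr 2
    exact (coroot'_weylGroup_smul (D.weylIso (dir g)) k y.1).symm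

theorem IsAffReflection.mul_self {r : D.W} {β : U × ℚ} (h : IsAffReflection r β) : r * r = 1 := by
  obtain ⟨k, hk, h⟩ := h
  refine eq_of_affAct_eq fun y => ?_
  rw [affAct_mul, affAct_one, h, h, Prod.fst_sub, Prod.smul_fst, map_sub, map_smul, hk,
    root_coroot'_eq_pairing, pairing_same, smul_eq_mul]
  module

theorem isAffReflection_finite {r : D.W0} {k : ιY} (h : D.weylIso r = weylGroup.ofIdx D.PY k) :
    IsAffReflection (SemidirectProduct.inr r : D.W) (D.PY.root k, 0) := by
  refine ⟨k, rfl, fun y => ?_⟩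
  have hw : (wt (SemidirectProduct.inr r : D.W) : V) = 0 := rfl
  have hd : dir (SemidirectProduct.inr r : D.W) = r := rfl
  rw [affAct, hw, hd, actY, h, weylGroup.ofIdx_smul_eq]
  ext <;> simp

variable (D) in
theorem isAffReflection_s (i : D.I) : IsAffReflection (D.s i) (D.affSimpleRoot i) := by
  cases i with
  | some i => exact isAffReflection_finite (D.weylIso_simple i)
  | none =>
    -- The element `t_ϑ s_ϑ` reflects in `δ - θ` because `(ϑ, y) = ⟨θ^∨, y⟩`.
    have hc := D.corresponds_vartheta_theta
    have hwt : (wt (D.s none) : V) = D.PX.root D.varthetaIdx := by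
      change D.PX.root D.varthetaIdx + (1 : D.W0) • (0 : V) = _
      simp
    have hd : D.weylIso (dir (D.s none)) = weylGroup.ofIdx D.PY D.thetaIdx := by
      rw [← hc.weylIso_ofIdx]
      change D.weylIso (1 * _) = _
      rw [one_mul]
      rfl
    let := D.PY.indexNeg
    refine ⟨-D.thetaIdx, ?_, fun y => ?_⟩
    · simp [affSimpleRoot]
    · have h1 : D.PY.coroot' (-D.thetaIdx) y.1 = - D.PY.coroot' D.thetaIdx y.1 := by simp
      rw [affAct, hwt, actY, hd, weylGroup.ofIdx_smul_eq, hc.latticePairing_left, spacing_theta, h1,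
        map_sub, map_smul, root_coroot'_eq_pairing, pairing_same]
      ext
      · simp [affSimpleRoot]
      · simp [affSimpleRoot]
        ring

variable (D) in
theorem s_mul_self (i : D.I) : D.s i * D.s i = 1 := (D.isAffReflection_s i).mul_self

variable (D) in
theorem s_inv (i : D.I) : (D.s i)⁻¹ = D.s i := inv_eq_of_mul_eq_one_left (D.s_mul_self i)

variable (D) in
theorem affAct_s_simple (i : D.I) : affAct (D.s i) (D.affSimpleRoot i) = -D.affSimpleRoot i := by
  obtain ⟨k, hk, h⟩ := D.isAffReflection_s i
  rw [h, hk, root_coroot'_eq_pairing, pairing_same]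
  module

/-- A simple affine reflection makes only one positive affine root negative. -/
theorem IsAffRoot.eq_simple {β : U × ℚ} (h : D.IsAffRoot β) (hβ : D.AffPos β) {i : D.I}
    (hi : ¬ D.AffPos (DoubleAffineDatum.affAct (D.s i) β)) : β = D.affSimpleRoot i := by
  obtain ⟨k, hk, hs⟩ := D.isAffReflection_s i
  have hneg := (h.affAct (D.s i)).affPos_or.resolve_left hi
  -- The reflection alters only the coordinate at `i`, so the others are both nonnegative and
  -- nonpositive. Thus `β` is a multiple of `α_i`, and reducedness leaves only `±α_i`.
  have h0 : ∀ j, i ≠ j → D.affCoord j β = 0 := by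
    intro j hj
    have h1 := hneg j
    rw [hs, map_neg, map_sub, map_smul, affCoord_simple_of_ne hj] at h1
    simp only [smul_zero, sub_zero, neg_nonneg] at h1
    exact le_antisymm h1 (hβ j)
  set a := D.affCoord i β with ha
  have h1 : β = a • D.affSimpleRoot i := by
    conv_lhs => rw [← sum_affCoord (D := D) β]
    rw [Finset.sum_eq_single i]
    · intro j _ hj
      rw [h0 j hj.symm, zero_smul]
    · simp
  obtain ⟨l, n, hl⟩ := h
  have h2 : D.PY.root l = a • D.PY.root k := by
    rw [← hk, ← Prod.smul_fst, ← h1, hl]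
  have h3 : ¬ LinearIndependent ℚ ![D.PY.root l, D.PY.root k] := by
    rw [LinearIndependent.pair_iff]
    intro h
    have := (h 1 (-a) (by rw [h2]; module)).1
    norm_num at this
  have h4 := D.PY.ne_zero k
  rcases IsReduced.eq_or_eq_neg l k h3 with h5 | h5
  · have : (a - 1) • D.PY.root k = 0 := by rw [sub_smul, ← h2, h5]; module
    have := (smul_eq_zero.1 this).resolve_right h4
    rw [h1, show a = 1 by linarith, one_smul]
  · have : (a + 1) • D.PY.root k = 0 := by rw [add_smul, ← h2, h5]; module
    have := (smul_eq_zero.1 this).resolve_right h4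
    have := hβ i
    linarith

/-! ### The exchange condition -/

variable (D) in
/-- The product of the simple reflections of a word. -/
def wordProd (L : List D.I) : D.W := (L.map D.s).prod

theorem wordProd_append (L L' : List D.I) :
    D.wordProd (L ++ L') = D.wordProd L * D.wordProd L' := by simp [wordProd]

theorem wordProd_cons (i : D.I) (L : List D.I) :
    D.wordProd (i :: L) = D.s i * D.wordProd L := by simp [wordProd]

theorem wordProd_reverse (L : List D.I) : D.wordProd L.reverse = (D.wordProd L)⁻¹ := by
  induction L with
  | nil => simp [wordProd]
  | cons i L ih =>
    rw [List.reverse_cons, wordProd_append, ih, wordProd_cons i L, mul_inv_rev, s_inv]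
    simp [wordProd]

/-- Apply the letters from the right: at the letter where the root first turns negative, it must be
the simple root of that letter. -/
theorem exists_simple_of_not_affPos (L : List D.I) {β : U × ℚ} (hβ : D.IsAffRoot β)
    (hpos : D.AffPos β) (hneg : ¬ D.AffPos (affAct (D.wordProd L) β)) :
    ∃ L₁ i L₂, L = L₁ ++ i :: L₂ ∧ affAct (D.wordProd L₂) β = D.affSimpleRoot i := by
  induction L with
  | nil => exact absurd hpos (by simpa [wordProd, affAct_one] using hneg)
  | cons i L ih =>
    by_cases h : D.AffPos (affAct (D.wordProd L) β)
    · rw [wordProd_cons, affAct_mul] at hneg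
      exact ⟨[], i, L, rfl, (hβ.affAct _).eq_simple h hneg⟩
    · obtain ⟨L₁, j, L₂, rfl, hj⟩ := ih h
      exact ⟨i :: L₁, j, L₂, rfl, hj⟩

/-- The strong exchange condition. -/
theorem exists_erase_of_not_affPos (L : List D.I) {β : U × ℚ} (hβ : D.IsAffRoot β)
    (hpos : D.AffPos β) (hneg : ¬ D.AffPos (affAct (D.wordProd L) β)) {r : D.W}
    (hr : IsAffReflection r β) :
    ∃ L₁ i L₂, L = L₁ ++ i :: L₂ ∧ D.wordProd L * r = D.wordProd (L₁ ++ L₂) := by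
  obtain ⟨L₁, i, L₂, rfl, hi⟩ := exists_simple_of_not_affPos L hβ hpos hneg
  refine ⟨L₁, i, L₂, rfl, ?_⟩
  -- Conjugating `r` by the word `L₂` gives `s_i`, which cancels the letter `i`.
  have h1 := hr.conj (D.wordProd L₂)
  rw [hi] at h1
  have h2 := h1.eq (D.isAffReflection_s i)
  rw [mul_inv_eq_iff_eq_mul] at h2
  rw [wordProd_append, wordProd_cons, wordProd_append, mul_assoc, mul_assoc, h2, ← mul_assoc (D.s i),
    s_mul_self, one_mul]

theorem length_le {w p : D.W} {L : List D.I} (hp : p ∈ D.PiY) (hw : w = p * D.wordProd L) :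
    length w ≤ L.length := by
  refine Nat.sInf_le ⟨p, L.get, hp, ?_⟩
  rw [hw, wordProd]
  congr 2
  rw [← Function.comp_def D.s, ← List.map_ofFn, List.ofFn_get]

theorem length_mul_lt {w p r : D.W} {L : List D.I} (hp : p ∈ D.PiY) (hw : w = p * D.wordProd L)
    {β : U × ℚ} (hβ : D.IsAffRoot β) (hpos : D.AffPos β) (hneg : ¬ D.AffPos (affAct w β))
    (hr : IsAffReflection r β) : length (w * r) < L.length := by
  obtain ⟨L₁, i, L₂, rfl, h⟩ := exists_erase_of_not_affPos L hβ hpos (fun h => hneg (by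
    rw [hw, affAct_mul]; exact affPos_affAct_of_mem_PiY hp h)) hr
  refine (length_le hp (L := L₁ ++ L₂) (by rw [hw, mul_assoc, h])).trans_lt ?_
  simp

/-! ### Lengths in the finite Weyl group -/

theorem length0_le (L : List D.I0) :
    D.length0 (L.map fun i : D.I0 => weylGroup.ofIdx D.PX i).prod ≤ L.length := by
  refine Nat.sInf_le ⟨L.get, ?_⟩
  congr 1
  conv_lhs => rw [← List.ofFn_get L, List.map_ofFn]
  rfl

theorem exists_word_length0 (w : D.W0) :
    ∃ L : List D.I0, L.length = D.length0 w ∧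
      w = (L.map fun i : D.I0 => weylGroup.ofIdx D.PX i).prod := by
  have hne : {n | ∃ word : Fin n → D.I0,
      w = (List.ofFn fun k => weylGroup.ofIdx D.PX (word k)).prod}.Nonempty := by
    obtain ⟨L, hL⟩ := D.baseX.exists_word w
    refine ⟨L.length, L.get, ?_⟩
    rw [hL]
    congr 1
    conv_lhs => rw [← List.ofFn_get L, List.map_ofFn]
    rfl
  obtain ⟨word, hw⟩ := Nat.sInf_mem hne
  refine ⟨List.ofFn word, by rw [List.length_ofFn]; rfl, hw.trans ?_⟩
  rw [List.map_ofFn]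
  rfl

theorem length0_mul_le (w w' : D.W0) : D.length0 (w * w') ≤ D.length0 w + D.length0 w' := by
  obtain ⟨L, hL, hw⟩ := D.exists_word_length0 w
  obtain ⟨L', hL', hw'⟩ := D.exists_word_length0 w'
  conv_lhs => rw [hw, hw', ← List.prod_append, ← List.map_append]
  refine (length0_le _).trans ?_
  rw [List.length_append, hL, hL']

theorem length0_simple_le (i : D.I0) : D.length0 (weylGroup.ofIdx D.PX i) ≤ 1 := by
  simpa using length0_le (D := D) [i]

theorem wordProd_map_some (L : List D.I0) :
    D.wordProd (L.map some) =
      SemidirectProduct.inr (L.map fun i : D.I0 => weylGroup.ofIdx D.PX i).prod := by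
  rw [wordProd, map_list_prod, List.map_map, List.map_map]
  rfl

theorem affAct_inr_root (w : D.W0) (k : ιY) :
    affAct (SemidirectProduct.inr w : D.W) (D.PY.root k, 0) =
      (D.PY.root (D.weylIso w • k), 0) := by
  have hw : (wt (SemidirectProduct.inr w : D.W) : V) = 0 := rfl
  rw [affAct, hw, ← weylGroup_smul_root]
  simp [actY]
  rfl

/-- The affine exchange condition suffices: erasing a letter from a word without the affine node
leaves a word of the same kind. -/
theorem length0_mul_lt {w r : D.W0} {k : ιY} (hr : D.weylIso r = weylGroup.ofIdx D.PY k)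
    (hk : D.baseY.IsPos k) (hw : ¬ D.baseY.IsPos (D.weylIso w • k)) :
    D.length0 (w * r) < D.length0 w := by
  obtain ⟨L, hL, hLw⟩ := D.exists_word_length0 w
  obtain ⟨L₁, i, L₂, h1, h2⟩ := exists_erase_of_not_affPos (L.map some) (isAffRoot_finite k)
    (affPos_finite_iff.2 hk) (by
      rwa [wordProd_map_some, ← hLw, affAct_inr_root, affPos_finite_iff])
    (isAffReflection_finite hr)
  obtain ⟨M₁, M, rfl, rfl, hM⟩ := List.map_eq_append_iff.1 h1
  obtain ⟨i, M₂, rfl, rfl, rfl⟩ := List.map_eq_cons_iff.1 hM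
  rw [wordProd_map_some, ← hLw, ← List.map_append, wordProd_map_some, ← map_mul] at h2
  rw [SemidirectProduct.inr_injective h2, ← hL]
  refine (length0_le _).trans_lt ?_
  simp

/-- Apply the previous lemma to `w r`, which sends the root `k` to the negative of its image under
`w`. -/
theorem lt_length0_mul {w r : D.W0} {k : ιY} (hr : D.weylIso r = weylGroup.ofIdx D.PY k)
    (hk : D.baseY.IsPos k) (hw : D.baseY.IsPos (D.weylIso w • k)) :
    D.length0 w < D.length0 (w * r) := by
  have hrr : r * r = 1 := D.weylIso.injective (by
    rw [map_mul, hr, weylGroup.ofIdx_mul_self, map_one])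
  have := length0_mul_lt (w := w * r) hr hk (fun h => by
    rw [map_mul, hr, mul_smul] at h
    have h1 := affPos_finite_iff.2 h
    have h2 := affPos_finite_iff.2 hw
    refine (isAffRoot_finite _).not_affPos_neg h2 ?_
    rw [← weylGroup_smul_root, ← weylGroup_smul_root, weylGroup.ofIdx_smul_eq,
      root_coroot'_eq_pairing, pairing_same, two_smul, sub_add_cancel_left, smul_neg,
      weylGroup_smul_root] at h1
    simpa using h1)
  rwa [mul_assoc, hrr, mul_one] at this

end DoubleAffineDatum
end

/-! ### Lengths of reflections, inversions of `m_λ`, and the change of length at a fold. -/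

noncomputable section
namespace DoubleAffineDatum

variable {ιX ιY V V' U U' : Type*} [Fintype ιX] [Fintype ιY]
  [AddCommGroup V] [Module ℚ V] [AddCommGroup V'] [Module ℚ V']
  [AddCommGroup U] [Module ℚ U] [AddCommGroup U'] [Module ℚ U']
  (D : DoubleAffineDatum ιX ιY V V' U U')

open RootPairing

/-! ### The functional `2ρ^∨` -/

open scoped Classical in
/-- `⟨2ρ^{∨Y}, ·⟩` as a linear map. -/
def twoRhoLin : U →ₗ[ℚ] ℚ := ∑ k : ιY, if D.baseY.IsPos k then D.PY.coroot' k else 0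

theorem twoRhoLin_apply (y : U) : D.twoRhoLin y = D.twoRhoCheck y := by
  classical
  rw [twoRhoLin, LinearMap.sum_apply, twoRhoCheck]
  refine Finset.sum_congr rfl fun k _ => ?_
  split_ifs <;> rfl

theorem isPos_simple_smul_iff {i k : ιY} (hi : i ∈ D.baseY.support) (h : k ≠ i)
    (h' : weylGroup.ofIdx D.PY i • k ≠ i) :
    D.baseY.IsPos (weylGroup.ofIdx D.PY i • k) ↔ D.baseY.IsPos k := by
  refine ⟨fun hp => ?_, fun hp => Base.IsPos.reflectionPerm hp hi h⟩
  have := Base.IsPos.reflectionPerm hp hi h'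
  rwa [← weylGroup.ofIdx_smul_idx, ← mul_smul, weylGroup.ofIdx_mul_self, one_smul] at this

theorem root_ofIdx_smul_self (k : ιY) :
    D.PY.root (weylGroup.ofIdx D.PY k • k) = -D.PY.root k := by
  rw [← weylGroup_smul_root, weylGroup.ofIdx_smul_eq, root_coroot'_eq_pairing, pairing_same,
    two_smul, sub_add_cancel_left]

theorem isPos_ofIdx_smul_self_iff (k : ιY) :
    D.baseY.IsPos (weylGroup.ofIdx D.PY k • k) ↔ ¬ D.baseY.IsPos k :=
  Base.IsPos.neg_iff_not D.baseY k

/-- A simple reflection permutes the positive roots other than `α_i`, so only the terms at `±α_i`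
survive in the difference. -/
theorem twoRhoCheck_reflection (i : D.baseY.support) (y : U) :
    D.twoRhoCheck (weylGroup.ofIdx D.PY i • y) =
      D.twoRhoCheck y - 2 * D.PY.coroot' i y := by
  classical
  set r := weylGroup.ofIdx D.PY i with hr
  have hrr : r * r = 1 := weylGroup.ofIdx_mul_self _
  have hi := Base.isPos_of_mem_support i.2
  have h1 : D.twoRhoCheck (r • y) =
      ∑ k : ιY, if D.baseY.IsPos (r • k) then D.PY.coroot' k y else 0 := by
    rw [twoRhoCheck, ← Equiv.sum_comp (MulAction.toPerm r)]
    refine Finset.sum_congr rfl fun k _ => ?_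
    rw [MulAction.toPerm_apply, coroot'_weylGroup_smul]
  suffices h : D.twoRhoCheck (r • y) - D.twoRhoCheck y = -(2 * D.PY.coroot' i y) by linarith
  rw [h1, twoRhoCheck, ← Finset.sum_sub_distrib]
  have hne : (i : ιY) ≠ r • (i : ιY) := fun h => by
    have h2 := D.root_ofIdx_smul_self i
    rw [← hr, ← h, eq_neg_iff_add_eq_zero, ← two_smul ℚ] at h2
    exact D.PY.ne_zero i ((smul_eq_zero.1 h2).resolve_left two_ne_zero)
  rw [← Finset.sum_subset (Finset.subset_univ {(i : ιY), r • (i : ιY)}), Finset.sum_pair hne,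
    ← mul_smul, hrr, one_smul]
  · have h3 : D.PY.coroot' (r • (i : ιY)) y = - D.PY.coroot' i y := by
      have := coroot'_weylGroup_smul r i (r • y)
      rw [← mul_smul, hrr, one_smul] at this
      rw [this, weylGroup.ofIdx_smul_eq, map_sub, map_smul, root_coroot'_eq_pairing, pairing_same,
        smul_eq_mul]
      ring
    have h4 : ¬ D.baseY.IsPos (r • (i : ιY)) :=
      (D.isPos_ofIdx_smul_self_iff i).not.2 (not_not.2 hi)
    rw [h3]
    simp only [if_pos hi, if_neg h4]
    ring
  · intro k _ hk
    rw [Finset.mem_insert, Finset.mem_singleton, not_or] at hk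
    have h4 : r • k ≠ i := fun h => hk.2 (by rw [← h, ← mul_smul, hrr, one_smul])
    simp only [hr, D.isPos_simple_smul_iff i.2 hk.1 h4, sub_self]

theorem twoRhoCheck_simple (i : D.baseY.support) : D.twoRhoCheck (D.PY.root i) = 2 := by
  have h := D.twoRhoCheck_reflection i (D.PY.root i)
  rw [weylGroup_smul_root, root_ofIdx_smul_self, ← twoRhoLin_apply, map_neg, twoRhoLin_apply,
    root_coroot'_eq_pairing, pairing_same] at h
  linarith

theorem exists_int_twoRhoCheck (k : ιY) : ∃ n : ℤ, D.twoRhoCheck (D.PY.root k) = n := by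
  classical
  refine ⟨∑ l : ιY, if D.baseY.IsPos l then D.PY.pairingIn ℤ k l else 0, ?_⟩
  push_cast
  refine Finset.sum_congr rfl fun l _ => ?_
  split_ifs
  · rw [root_coroot'_eq_pairing, intCast_pairingIn]
  · rfl

/-- `ℓ(s_α) ≤ ⟨2ρ^∨, α⟩ - 1` for a positive root `α`. -/
theorem length0_reflection_le {k : ιY} (hk : D.baseY.IsPos k) :
    2 ≤ D.twoRhoCheck (D.PY.root k) ∧
      (D.length0 (D.weylIso.symm (weylGroup.ofIdx D.PY k)) : ℚ) + 1 ≤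
        D.twoRhoCheck (D.PY.root k) := by
  -- Induct through a simple `α_i` with `⟨β, α_i^∨⟩ > 0`. Passing from `s_i β` to `β` conjugates the
  -- reflection by `s_i`, adding at most 2 to the length, and adds `2⟨β, α_i^∨⟩ ≥ 2` to `⟨2ρ^∨, ·⟩`.
  induction hN : (D.baseY.height k).toNat using Nat.strong_induction_on generalizing k with
  | _ N ih =>
  have hsimple (i : D.I0) :
      D.weylIso.symm (weylGroup.ofIdx D.PY (D.node i)) = weylGroup.ofIdx D.PX i := by
    rw [← D.weylIso_simple, MulEquiv.symm_apply_apply]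
  obtain ⟨j, hj, hjk⟩ := hk.exists_mem_support_pos_pairingIn
  rw [D.PY.zero_lt_pairingIn_iff'] at hjk
  obtain ⟨i, hi⟩ := D.node.surjective ⟨j, hj⟩
  obtain rfl : (D.node i : ιY) = j := congrArg Subtype.val hi
  by_cases hkj : k = D.node i
  · rw [hkj, hsimple, twoRhoCheck_simple]
    refine ⟨le_rfl, ?_⟩
    have : (D.length0 (weylGroup.ofIdx D.PX i) : ℚ) ≤ 1 := by exact_mod_cast D.length0_simple_le i
    linarith
  · set r := weylGroup.ofIdx D.PY (D.node i) with hr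
    have hpos : D.baseY.IsPos (r • k) := Base.IsPos.reflectionPerm hk hj hkj
    have h1 := D.PY.reflection_apply_root' ℤ (i := D.node i) (j := k)
    rw [← root_reflectionPerm, sub_eq_add_neg, ← neg_smul] at h1
    have h2 := D.baseY.height_add_zsmul h1
    rw [Base.height_one_of_mem_support hj, ← weylGroup.ofIdx_smul_idx, ← hr] at h2
    have h3 : 0 < D.baseY.height (r • k) := hpos
    simp only [smul_eq_mul, mul_one] at h2
    obtain ⟨h4, h5⟩ := ih (D.baseY.height (r • k)).toNat (by omega) hpos rfl
    have h6 := D.twoRhoCheck_reflection (D.node i) (D.PY.root k)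
    rw [← hr, weylGroup_smul_root, root_coroot'_eq_pairing, ← intCast_pairingIn] at h6
    have h7 : (1 : ℚ) ≤ D.PY.pairingIn ℤ k (D.node i) := by exact_mod_cast hjk
    have hinv : r⁻¹ = r := inv_eq_of_mul_eq_one_left (weylGroup.ofIdx_mul_self _)
    have h8 : weylGroup.ofIdx D.PY k = r * weylGroup.ofIdx D.PY (r • k) * r := by
      have h := weylGroup.conj_ofIdx r (r • k)
      rw [← mul_smul, weylGroup.ofIdx_mul_self, one_smul, hinv] at h
      exact h.symm
    have h9 := length0_mul_le (weylGroup.ofIdx D.PX i *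
      D.weylIso.symm (weylGroup.ofIdx D.PY (r • k))) (weylGroup.ofIdx D.PX i)
    have h10 := length0_mul_le (weylGroup.ofIdx D.PX i)
      (D.weylIso.symm (weylGroup.ofIdx D.PY (r • k)))
    have h11 := D.length0_simple_le i
    have h12 : D.length0 (D.weylIso.symm (weylGroup.ofIdx D.PY k)) ≤
        D.length0 (D.weylIso.symm (weylGroup.ofIdx D.PY (r • k))) + 2 := by
      rw [h8, map_mul, map_mul, hr, hsimple]
      rw [hr] at h9 h10
      omega
    have h13 : (D.length0 (D.weylIso.symm (weylGroup.ofIdx D.PY k)) : ℚ) ≤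
        D.length0 (D.weylIso.symm (weylGroup.ofIdx D.PY (r • k))) + 2 := by exact_mod_cast h12
    constructor <;> linarith

variable {D}

/-! ### Inversions of minimal coset representatives -/

/-- The inversions of the element of minimum length in a coset `t_x W₀` have negative finite
parts. -/
theorem exists_pos_of_inversion {x : D.X} {m p : D.W} (hm : D.IsMinCosetRep x m)
    {L₁ L₂ : List D.I} {i : D.I} (hp : p ∈ D.PiY) (hw : m = p * D.wordProd (L₁ ++ i :: L₂))
    (hlen : (L₁ ++ i :: L₂).length = length m) :
    ∃ k, D.baseY.IsPos k ∧
      (affAct (D.wordProd L₂)⁻¹ (D.affSimpleRoot i)).1 = -D.PY.root k := by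
  set β := affAct (D.wordProd L₂)⁻¹ (D.affSimpleRoot i) with hβdef
  have hβ : D.IsAffRoot β := (D.isAffRoot_simple i).affAct _
  have hshort (L : List D.I) (h : m = p * D.wordProd L) :
      (L₁ ++ i :: L₂).length ≤ L.length := hlen ▸ length_le hp h
  -- Otherwise exchange would replace `s_i L₂` by a word two letters shorter.
  have hβpos : D.AffPos β := by
    by_contra hneg
    rw [hβdef, ← wordProd_reverse] at hneg
    obtain ⟨A, a, B, hAB, h⟩ := exists_erase_of_not_affPos L₂.reverse (D.isAffRoot_simple i)
      (D.affPos_simple i) hneg (D.isAffReflection_s i)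
    have h1 : D.s i * D.wordProd L₂ = D.wordProd (A ++ B).reverse := by
      rw [wordProd_reverse, ← h, wordProd_reverse, mul_inv_rev, inv_inv, s_inv]
    have h2 := hshort (L₁ ++ (A ++ B).reverse) (by
      rw [hw, wordProd_append, wordProd_cons, h1, ← wordProd_append])
    have h3 := congrArg List.length hAB
    simp only [List.length_append, List.length_cons, List.length_reverse] at h2 h3
    omega
  have hmβ : D.AffPos (-affAct m β) := by
    have h1 : affAct m β = -affAct p (affAct (D.wordProd L₁) (D.affSimpleRoot i)) := by
      rw [hw, hβdef, wordProd_append, wordProd_cons, affAct_mul, affAct_mul, affAct_mul,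
        affAct_affAct_inv, affAct_s_simple, affAct_neg, affAct_neg]
    rw [h1, neg_neg]
    refine affPos_affAct_of_mem_PiY hp ?_
    by_contra hneg
    obtain ⟨A, a, B, rfl, h⟩ := exists_erase_of_not_affPos L₁ (D.isAffRoot_simple i)
      (D.affPos_simple i) hneg (D.isAffReflection_s i)
    have h2 := hshort (A ++ B ++ L₂) (by
      rw [hw, wordProd_append, wordProd_cons, ← mul_assoc (D.wordProd _), h, ← wordProd_append])
    simp at h2
  obtain ⟨k, n, hk⟩ := hβ
  by_cases hkpos : D.baseY.IsPos k
  -- Now `β = k + a δ` with `a ≥ 0`, so `m` makes `k` negative along with `β`. Hence `m` makes some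
  -- finite simple root `α_l` negative, and `m s_l` is a shorter element of the same coset.
  · exfalso
    have ha : 0 ≤ D.spacing k * n := by
      have h := hβpos none
      rwa [hk] at h
    have h1 : β = (D.PY.root k, 0) + (0, D.spacing k * n) := by rw [hk]; ext <;> simp
    have h2 : D.AffPos (-affAct m (D.PY.root k, 0)) := by
      intro j
      have h3 := hmβ j
      have h4 := D.affPos_delta ha j
      rw [h1, ← affLin_apply, map_add, affLin_apply, affLin_apply, affAct_delta, neg_add, map_add,
        map_neg _ (0, D.spacing k * (n : ℚ))] at h3
      linarith
    obtain ⟨l, hl⟩ : ∃ l : D.I0, ¬ D.AffPos (affAct m (D.affSimpleRoot (some l))) := by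
      by_contra! h
      refine ((isAffRoot_finite k).affAct m).not_affPos_neg ?_ h2
      rw [← affLin_apply, ← sum_affCoord (D := D) (D.PY.root k, 0), map_sum]
      refine AffPos.sum fun j _ => ?_
      rw [map_smul]
      cases j with
      | none => rw [affCoord_none, zero_smul]; exact affPos_delta le_rfl
      | some j => exact (h j).smul (affPos_finite_iff.2 hkpos _)
    have h3 := length_mul_lt hp hw (D.isAffRoot_simple (some l)) (D.affPos_simple _) hl
      (D.isAffReflection_s _)
    obtain ⟨⟨g, hg⟩, hmin⟩ := hm
    have h4 := hmin (g * weylGroup.ofIdx D.PX l)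
    rw [map_mul, ← mul_assoc, ← hg] at h4
    rw [hlen] at h3
    exact absurd h3 (not_lt.2 h4)
  · refine ⟨weylGroup.ofIdx D.PY k • k, (D.isPos_ofIdx_smul_self_iff k).2 hkpos, ?_⟩
    rw [root_ofIdx_smul_self, hk, neg_neg]

/-- The change of length along a fold, compared with the edges of the quantum Bruhat graph. -/
theorem fold_step {w w' : D.W0} {k : ιY} (hk : D.baseY.IsPos k)
    (hw' : D.weylIso w' = D.weylIso w * weylGroup.ofIdx D.PY k) :
    (D.baseY.IsPos (D.weylIso w • k) →
      D.length0 w + 1 ≤ D.length0 w' ∧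
        (D.length0 w' = D.length0 w + 1 ↔ D.QBEdge w w' (D.PY.root k))) ∧
    (¬ D.baseY.IsPos (D.weylIso w • k) →
      (D.length0 w : ℚ) - D.twoRhoCheck (D.PY.root k) + 1 ≤ D.length0 w' ∧
        ((D.length0 w' : ℚ) = D.length0 w - D.twoRhoCheck (D.PY.root k) + 1 ↔
          D.QBEdge w w' (D.PY.root k))) := by
  set r := D.weylIso.symm (weylGroup.ofIdx D.PY k) with hr
  have hr' : D.weylIso r = weylGroup.ofIdx D.PY k := MulEquiv.apply_symm_apply _ _
  have hrr : r * r = 1 := D.weylIso.injective (by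
    rw [map_mul, hr', weylGroup.ofIdx_mul_self, map_one])
  have hww' : w' = w * r := D.weylIso.injective (by rw [hw', map_mul, hr'])
  obtain ⟨h2, hlen⟩ := D.length0_reflection_le hk
  have hedge : D.QBEdge w w' (D.PY.root k) ↔ (D.length0 w' = D.length0 w + 1 ∨
      (D.length0 w' : ℚ) = D.length0 w - D.twoRhoCheck (D.PY.root k) + 1) :=
    ⟨fun ⟨_, _, _, _, h⟩ => h, fun h => ⟨k, hk, rfl, hw', h⟩⟩
  rw [hedge]
  -- In the first case the length grows, while a quantum edge would lower it since `⟨2ρ^∨, α⟩ ≥ 2`.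
  -- In the second case it falls, which excludes an ordinary edge.
  constructor
  · intro hpos
    have h1 := lt_length0_mul hr' hk hpos
    rw [← hww'] at h1
    have h1' : (D.length0 w : ℚ) + 1 ≤ D.length0 w' := by exact_mod_cast h1
    exact ⟨h1, Or.inl, fun h => h.resolve_right fun h => by linarith⟩
  · intro hneg
    have h1 := length0_mul_lt hr' hk hneg
    rw [← hww'] at h1
    -- From `w = w' r`, the fall in length is at most `ℓ(r)`.
    have h3 : D.length0 w ≤ D.length0 w' + D.length0 r := by
      refine le_trans (le_of_eq ?_) (length0_mul_le w' r)
      rw [hww', mul_assoc, hrr, mul_one]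
    have h3' : (D.length0 w : ℚ) ≤ D.length0 w' + D.length0 r := by exact_mod_cast h3
    exact ⟨by linarith, Or.inr, fun h => h.resolve_left fun h => by omega⟩

theorem IsAffReflection.weylIso_dir {r : D.W} {β : U × ℚ} (h : IsAffReflection r β) {k : ιY}
    (hk : β.1 = -D.PY.root k) : D.weylIso (dir r) = weylGroup.ofIdx D.PY k := by
  let := D.PY.indexNeg
  obtain ⟨l, hl, h⟩ := h
  have hlk : l = -k := D.PY.root.injective (by rw [← hl, hk]; simp)
  refine weylGroup_ext fun y => ?_
  have h1 : D.weylIso (dir r) • y = y - D.PY.coroot' l y • β.1 := congrArg Prod.fst (h (y, 0))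
  rw [h1, hk, hlk, weylGroup.ofIdx_smul_eq]
  simp

end DoubleAffineDatum
end

noncomputable section

/-! ### Orders of Laurent series -/

namespace HahnSeries

variable {K : Type*} [Field K]

theorem order_prod_laurent {α : Type*} {s : Finset α} {f : α → LaurentSeries K}
    (hf : ∀ a ∈ s, f a ≠ 0) : (∏ a ∈ s, f a).order = ∑ a ∈ s, (f a).order := by
  classical
  induction s using Finset.induction_on with
  | empty => simp
  | insert a s ha ih =>
    rw [Finset.prod_insert ha, Finset.sum_insert ha,
      order_mul (hf a (Finset.mem_insert_self a s))
        (Finset.prod_ne_zero_iff.2 fun b hb => hf b (Finset.mem_insert_of_mem hb)),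
      ih fun b hb => hf b (Finset.mem_insert_of_mem hb)]

theorem order_inv_laurent {f : LaurentSeries K} (hf : f ≠ 0) : f⁻¹.order = -f.order := by
  have h := order_mul hf (inv_ne_zero hf)
  rw [mul_inv_cancel₀ hf, order_one] at h
  omega

theorem order_zpow_laurent {f : LaurentSeries K} (hf : f ≠ 0) (n : ℤ) :
    (f ^ n).order = n * f.order := by
  cases n with
  | ofNat n => simp
  | negSucc n =>
    rw [zpow_negSucc, order_inv_laurent (pow_ne_zero _ hf), order_pow, Int.negSucc_eq]
    ring

theorem one_add_laurent {f : LaurentSeries K} (hf : 0 < f.order) :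
    1 + f ≠ 0 ∧ (1 + f).order = 0 := by
  have h : (1 + f).orderTop = 0 := by
    rw [orderTop_add_eq_left, orderTop_one]
    rw [orderTop_one]
    exact zero_lt_orderTop_of_order hf
  have h0 : 1 + f ≠ 0 := fun h' => by simp [h'] at h
  refine ⟨h0, ?_⟩
  rw [← order_eq_orderTop_of_ne_zero h0] at h
  exact_mod_cast h

theorem one_sub_laurent {f : LaurentSeries K} (hf : 0 < f.order) :
    1 - f ≠ 0 ∧ (1 - f).order = 0 := by
  rw [sub_eq_add_neg]
  exact one_add_laurent (by rwa [order_neg])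

/-- The numerator is `c (1 + ξ)`, and both `1 + ξ` and `1 - ξ²` have order 0. -/
theorem order_fold_pos {c ξ : LaurentSeries K} (hc : c ≠ 0) (hξ : 0 < ξ.order) :
    (c + c * ξ) / (1 - ξ ^ 2) ≠ 0 ∧ ((c + c * ξ) / (1 - ξ ^ 2)).order = c.order := by
  obtain ⟨h1, h2⟩ := one_add_laurent hξ
  obtain ⟨h3, h4⟩ := one_sub_laurent (f := ξ ^ 2) (by rw [order_pow]; positivity)
  have h5 : c + c * ξ = c * (1 + ξ) := by ring
  rw [h5]
  refine ⟨div_ne_zero (mul_ne_zero hc h1) h3, ?_⟩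
  rw [div_eq_mul_inv, order_mul (mul_ne_zero hc h1) (inv_ne_zero h3), order_mul hc h1,
    order_inv_laurent h3, h2, h4]
  simp

theorem order_fold_neg {c ξ : LaurentSeries K} (hc : c ≠ 0) (hξ : 0 < ξ.order) :
    (c * ξ ^ 2 + c * ξ) / (1 - ξ ^ 2) ≠ 0 ∧
      ((c * ξ ^ 2 + c * ξ) / (1 - ξ ^ 2)).order = c.order + ξ.order := by
  -- The zero series has order 0 by convention, so positive order excludes it.
  have h0 : ξ ≠ 0 := by rintro rfl; simp at hξ
  obtain ⟨h1, h2⟩ := order_fold_pos (mul_ne_zero hc h0) hξ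
  rw [order_mul hc h0] at h2
  rw [show c * ξ ^ 2 + c * ξ = c * ξ + c * ξ * ξ by ring]
  exact ⟨h1, h2⟩

end HahnSeries

/-! ### Orders of the scalars, and telescoping along an alcove path. -/

namespace DoubleAffineDatum

variable {ιX ιY V V' U U' : Type*} [Fintype ιX] [Fintype ιY]
  [AddCommGroup V] [Module ℚ V] [AddCommGroup V'] [Module ℚ V']
  [AddCommGroup U] [Module ℚ U] [AddCommGroup U'] [Module ℚ U']
  {D : DoubleAffineDatum ιX ιY V V' U U'}

open RootPairing

section Scalars

variable (F : Type*) [Field F]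

theorem vElt_ne_zero : vElt F ≠ 0 := HahnSeries.single_ne_zero one_ne_zero

theorem order_vElt : (vElt F).order = 1 := HahnSeries.order_single one_ne_zero

theorem order_vElt_inv_sub : (vElt F)⁻¹ - vElt F ≠ 0 ∧ ((vElt F)⁻¹ - vElt F).order = -1 := by
  have h0 := vElt_ne_zero F
  obtain ⟨h1, h2⟩ := HahnSeries.one_sub_laurent (f := vElt F ^ 2) (by
    rw [HahnSeries.order_pow, order_vElt]; norm_num)
  have h : (vElt F)⁻¹ - vElt F = (vElt F)⁻¹ * (1 - vElt F ^ 2) := by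
    field_simp
  rw [h]
  refine ⟨mul_ne_zero (inv_ne_zero h0) h1, ?_⟩
  rw [HahnSeries.order_mul (inv_ne_zero h0) h1, HahnSeries.order_inv_laurent h0, h2, order_vElt]
  norm_num

/-- The scalar `q` is a nonzero constant, of order 0 in `v`. -/
theorem order_xi {n : ℕ} (word : Fin n → D.I) (j : Fin n) :
    (xi word F j).order = ⌊D.twoRhoCheck (-(beta word j).1)⌋ := by
  have hq : qElt F ≠ 0 := by
    rw [qElt, Ne, map_eq_zero_iff _ HahnSeries.C_injective]
    exact RatFunc.X_ne_zero
  have hv := vElt_ne_zero F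
  rw [xi, HahnSeries.order_mul (zpow_ne_zero _ hq) (zpow_ne_zero _ hv),
    HahnSeries.order_zpow_laurent hq, HahnSeries.order_zpow_laurent hv, order_vElt, qElt,
    HahnSeries.order_C]
  ring

end Scalars

section Path

variable {n : ℕ} (u p : D.W) (word : Fin n → D.I) (J : Finset (Fin n))

theorem tailElt_eq (j : Fin n) :
    tailElt word j = (D.wordProd ((List.ofFn word).drop (j + 1)))⁻¹ := by
  rw [← wordProd_reverse, wordProd, tailElt, List.map_reverse, List.map_drop, List.map_ofFn]
  rfl

theorem isAffReflection_sBeta (j : Fin n) : IsAffReflection (sBeta word j) (beta word j) :=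
  (D.isAffReflection_s (word j)).conj _

theorem ofFn_eq_take_append_cons (j : Fin n) :
    List.ofFn word =
      (List.ofFn word).take j ++ word j :: (List.ofFn word).drop (j + 1) := by
  conv_lhs => rw [← List.take_append_drop j (List.ofFn word)]
  rw [List.drop_eq_getElem_cons (by simp)]
  simp

/-- Every `-β̄_j` is a positive root. -/
theorem exists_pos_neg_beta {x : D.X} {m : D.W} (hm : D.IsMinCosetRep x m)
    (hred : IsReducedExpression m p word) (j : Fin n) :
    ∃ k, D.baseY.IsPos k ∧ (beta word j).1 = -D.PY.root k := by
  obtain ⟨⟨hp, hw⟩, hn⟩ := hred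
  have h := ofFn_eq_take_append_cons word j
  rw [beta, tailElt_eq]
  refine exists_pos_of_inversion (L₁ := (List.ofFn word).take j) hm hp ?_ ?_
  · rw [← h, wordProd, List.map_ofFn, hw]
    rfl
  · rw [← h, List.length_ofFn, hn]

/-- The element `u_m s_{i_{m+1}} ⋯ s_{i_n}`, the value of the path after the folds among the first
`m` positions. -/
def pathAt (m : ℕ) : D.W :=
  u * p * ((List.ofFn fun k => if k ∈ J then 1 else D.s (word k)).take m).prod *
    D.wordProd ((List.ofFn word).drop m)

theorem pathAt_zero : pathAt u p word J 0 = zStart u p word := by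
  rw [pathAt, zStart, wordProd, List.drop_zero, List.map_ofFn, List.take_zero, List.prod_nil,
    mul_one, mul_assoc]
  rfl

theorem pathAt_eq (j : Fin n) :
    pathAt u p word J j = before u p word J j * (D.s (word j) * (tailElt word j)⁻¹) := by
  rw [pathAt, before, tailElt_eq, inv_inv, ← wordProd_cons, List.drop_eq_getElem_cons (by simp)]
  simp

/-- Right multiplication by `s_{β_j}` deletes the factor `s_{i_j}`. So `pathAt` runs through `z_0,
…, z_r`, pausing at unfolded positions. -/
theorem pathAt_succ (j : Fin n) :
    pathAt u p word J (j + 1) =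
      if j ∈ J then pathAt u p word J j * sBeta word j else pathAt u p word J j := by
  have h : pathAt u p word J (j + 1) = before u p word J j *
      ((if j ∈ J then 1 else D.s (word j)) * (tailElt word j)⁻¹) := by
    rw [pathAt, before, tailElt_eq, inv_inv, List.take_add_one,
      List.getElem?_eq_getElem (by simp)]
    simp [mul_assoc]
  rw [h, pathAt_eq]
  split_ifs
  · rw [sBeta, one_mul]
    simp only [mul_assoc, inv_mul_cancel_left]
    rw [← mul_assoc (D.s _), s_mul_self, one_mul]
  · rfl

theorem sort_eq_filter : J.sort (· ≤ ·) = (List.finRange n).filter (· ∈ J) := by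
  refine J.sortedLT_sort.eq_of_mem_iff
    ((List.sortedLT_finRange n).pairwise.filter _).sortedLT (by simp)


-- This turns the sign of a fold into the sign of `dir(z)` applied to `-β̄_j`, where `z` is the
-- value of the path before the fold.
variable {u p J} in
theorem affAct_pathAt_beta (j : Fin n) : affAct (pathAt u p word J j) (beta word j) =
    -affAct (before u p word J j) (D.affSimpleRoot (word j)) := by
  rw [pathAt_eq, beta, affAct_mul, affAct_mul, affAct_inv_affAct, affAct_s_simple, affAct_neg]

variable {word}

theorem exists_affAct_before_eq {j : Fin n} {k : ιY} (hk : (beta word j).1 = -D.PY.root k) :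
    ∃ a : ℤ, affAct (before u p word J j) (D.affSimpleRoot (word j)) =
      (D.PY.root (D.weylIso (dir (pathAt u p word J j)) • k), (a : ℚ)) := by
  have h1 := congrArg Prod.fst (affAct_pathAt_beta (u := u) (p := p) (J := J) word j)
  have h2 : D.weylIso (dir (pathAt u p word J j)) • (beta word j).1 =
      -(affAct (before u p word J j) (D.affSimpleRoot (word j))).1 := h1
  rw [hk, smul_neg, neg_inj, weylGroup_smul_root] at h2
  obtain ⟨l, b, hl⟩ := (D.isAffRoot_simple (word j)).affAct (before u p word J j)
  -- Integrality of the spacing puts the coefficient of `δ` in `ℤ`, as the definition of the signs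
  -- demands.
  obtain ⟨c, hc⟩ := D.spacing_int l
  rw [hl] at h2 ⊢
  exact ⟨c * b, by rw [h2, hc, Int.cast_mul]⟩

theorem signPos_iff {j : Fin n} {k : ιY} (hk : (beta word j).1 = -D.PY.root k) :
    SignPos u p word J j ↔ D.baseY.IsPos (D.weylIso (dir (pathAt u p word J j)) • k) := by
  obtain ⟨a, ha⟩ := exists_affAct_before_eq u p J hk
  constructor
  · rintro ⟨b, l, hl, h⟩
    rw [ha] at h
    rwa [D.PY.root.injective (congrArg Prod.fst h)]
  · exact fun h => ⟨a, _, h, ha⟩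

theorem signNeg_iff {j : Fin n} {k : ιY} (hk : (beta word j).1 = -D.PY.root k) :
    SignNeg u p word J j ↔ ¬ D.baseY.IsPos (D.weylIso (dir (pathAt u p word J j)) • k) := by
  obtain ⟨a, ha⟩ := exists_affAct_before_eq u p J hk
  rw [← isPos_ofIdx_smul_self_iff]
  constructor
  · rintro ⟨b, l, hl, h⟩
    rw [ha] at h
    have h1 : D.PY.root (D.weylIso (dir (pathAt u p word J j)) • k) = -D.PY.root l :=
      congrArg Prod.fst h
    rw [← neg_eq_iff_eq_neg, ← root_ofIdx_smul_self] at h1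
    rwa [D.PY.root.injective h1]
  · exact fun h => ⟨a, _, h, by rw [root_ofIdx_smul_self, neg_neg, ha]⟩

variable (word) in
open scoped Classical in
/-- The contribution of a fold to `ord`. -/
def foldCost (j : Fin n) : ℚ :=
  -1 + if SignNeg u p word J j then D.twoRhoCheck (-(beta word j).1) else 0

/-- Both signs of `fold_step` take the same form in terms of the cost, ready to be summed. -/
theorem fold_cost_step (hβ : ∀ j, ∃ k, D.baseY.IsPos k ∧ (beta word j).1 = -D.PY.root k)
    (j : Fin n) :
    (D.length0 (dir (pathAt u p word J j)) : ℚ) ≤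
        D.length0 (dir (pathAt u p word J j * sBeta word j)) + foldCost u p word J j ∧
      ((D.length0 (dir (pathAt u p word J j)) : ℚ) =
        D.length0 (dir (pathAt u p word J j * sBeta word j)) + foldCost u p word J j ↔
        D.QBEdge (dir (pathAt u p word J j)) (dir (pathAt u p word J j * sBeta word j))
          (-(beta word j).1)) := by
  obtain ⟨k, hk, hkβ⟩ := hβ j
  have hw' : D.weylIso (dir (pathAt u p word J j * sBeta word j)) =
      D.weylIso (dir (pathAt u p word J j)) * weylGroup.ofIdx D.PY k := by
    rw [dir_mul, map_mul, (isAffReflection_sBeta word j).weylIso_dir hkβ]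
  obtain ⟨h1, h2⟩ := fold_step hk hw'
  rw [foldCost, hkβ, neg_neg]
  by_cases hpos : D.baseY.IsPos (D.weylIso (dir (pathAt u p word J j)) • k)
  · obtain ⟨h3, h4⟩ := h1 hpos
    rw [if_neg ((signNeg_iff u p J hkβ).not.2 (not_not.2 hpos)), ← h4, add_zero, ← sub_eq_add_neg]
    have h3' : (D.length0 (dir (pathAt u p word J j)) : ℚ) + 1 ≤
        D.length0 (dir (pathAt u p word J j * sBeta word j)) := by exact_mod_cast h3
    refine ⟨by linarith, ?_⟩
    rw [eq_sub_iff_add_eq, eq_comm]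
    exact_mod_cast Iff.rfl
  · obtain ⟨h3, h4⟩ := h2 hpos
    rw [if_pos ((signNeg_iff u p J hkβ).2 hpos), ← h4]
    exact ⟨by linarith, by constructor <;> intro h <;> linarith⟩

/-- Downward induction on `m` makes the list of remaining folds grow at its head, as in
`IsQBPathFrom`. All inequalities point the same way, so the total is an equality only if each step
is. -/
theorem path_cost (hβ : ∀ j, ∃ k, D.baseY.IsPos k ∧ (beta word j).1 = -D.PY.root k)
    {m : ℕ} (hm : m ≤ n) :
    let l := ((List.finRange n).drop m).filter (· ∈ J)
    l.foldl (fun z j => z * sBeta word j) (pathAt u p word J m) = pathAt u p word J n ∧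
      (D.length0 (dir (pathAt u p word J m)) : ℚ) ≤
        D.length0 (dir (pathAt u p word J n)) + (l.map (foldCost u p word J)).sum ∧
      ((D.length0 (dir (pathAt u p word J m)) : ℚ) =
        D.length0 (dir (pathAt u p word J n)) + (l.map (foldCost u p word J)).sum ↔
        IsQBPathFrom word (pathAt u p word J m) l) := by
  induction hm using Nat.decreasingInduction with
  | self =>
    have h : (List.finRange n).drop n = [] := List.drop_eq_nil_of_le (by simp)
    simp [h, IsQBPathFrom]
  | of_succ m hm ih =>
    have h : (List.finRange n).drop m = ⟨m, hm⟩ :: (List.finRange n).drop (m + 1) := by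
      rw [List.drop_eq_getElem_cons (by simpa using hm)]
      simp
    have hs := pathAt_succ u p word J ⟨m, hm⟩
    by_cases hJ : (⟨m, hm⟩ : Fin n) ∈ J
    · rw [if_pos hJ] at hs
      obtain ⟨h1, h2, h3⟩ := ih
      obtain ⟨h4, h5⟩ := fold_cost_step u p J hβ ⟨m, hm⟩
      dsimp only at hs h4 h5
      rw [h, List.filter_cons_of_pos (by simpa using hJ)]
      rw [hs] at h1 h2 h3
      refine ⟨h1, ?_, ?_⟩
      · rw [List.map_cons, List.sum_cons]
        linarith
      · rw [List.map_cons, List.sum_cons, IsQBPathFrom, ← h5, ← h3]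
        constructor
        · intro h6
          constructor <;> linarith
        · rintro ⟨h6, h7⟩
          linarith
    · rw [if_neg hJ] at hs
      dsimp only at hs
      rw [h, List.filter_cons_of_neg (by simpa using hJ), ← hs]
      exact ih

theorem pathEnd_eq (hβ : ∀ j, ∃ k, D.baseY.IsPos k ∧ (beta word j).1 = -D.PY.root k) :
    pathEnd u p word J = pathAt u p word J n := by
  rw [← (path_cost u p J hβ n.zero_le).1, pathEnd, sort_eq_filter, pathAt_zero, List.drop_zero]

theorem sum_foldCost : ((J.sort (· ≤ ·)).map (foldCost u p word J)).sum =
    -J.card - D.twoRhoCheck (qwt u p word J).1 := by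
  classical
  rw [← List.sum_toFinset _ (Finset.sort_nodup _ _), Finset.sort_toFinset]
  unfold foldCost
  rw [Finset.sum_add_distrib, ← Finset.sum_filter, qwt, Prod.fst_sum, ← twoRhoLin_apply, map_sum,
    sub_eq_add_neg, ← Finset.sum_neg_distrib]
  congr 1
  · simp
  · refine Finset.sum_congr ?_ fun j _ => ?_
    · ext
      simp [foldsNeg]
    · rw [← twoRhoLin_apply, map_neg]

variable (F : Type*) [Field F]

theorem ord_eq (hβ : ∀ j, ∃ k, D.baseY.IsPos k ∧ (beta word j).1 = -D.PY.root k) :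
    (ord u p word J F : ℚ) = D.length0 (dir (pathEnd u p word J)) - J.card -
      D.twoRhoCheck (qwt u p word J).1 := by
  classical
  obtain ⟨hc, hc'⟩ := order_vElt_inv_sub F
  have hξ (j : Fin n) : ((xi word F j).order : ℚ) = D.twoRhoCheck (-(beta word j).1) ∧
      0 < (xi word F j).order := by
    obtain ⟨k, hk, hkβ⟩ := hβ j
    obtain ⟨a, ha⟩ := D.exists_int_twoRhoCheck k
    have h2 := (D.length0_reflection_le hk).1
    rw [order_xi, hkβ, neg_neg, ha, Int.floor_intCast]
    refine ⟨rfl, ?_⟩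
    rw [ha] at h2
    have : (2 : ℤ) ≤ a := by exact_mod_cast h2
    omega
  have hpos (j : Fin n) := HahnSeries.order_fold_pos hc (hξ j).2
  have hneg (j : Fin n) := HahnSeries.order_fold_neg hc (hξ j).2
  -- Each fold has exactly one sign, so the factors `v⁻¹ - v` together contribute `-|J|`.
  have hfolds : foldsPos u p word J = {j ∈ J | ¬ SignNeg u p word J j} := by
    refine Finset.filter_congr fun j _ => ?_
    obtain ⟨k, hk, hkβ⟩ := hβ j
    rw [signPos_iff u p J hkβ, signNeg_iff u p J hkβ, not_not]
  have hcard : ((foldsPos u p word J).card : ℚ) + (foldsNeg u p word J).card = J.card := by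
    rw [hfolds, add_comm, foldsNeg]
    exact_mod_cast Finset.card_filter_add_card_filter_not _
  have hv := pow_ne_zero (D.length0 (dir (pathEnd u p word J))) (vElt_ne_zero F)
  have h1 := Finset.prod_ne_zero_iff.2 fun j (_ : j ∈ foldsPos u p word J) => (hpos j).1
  have h2 := Finset.prod_ne_zero_iff.2 fun j (_ : j ∈ foldsNeg u p word J) => (hneg j).1
  rw [ord, summand, HahnSeries.order_mul (mul_ne_zero hv h1) h2, HahnSeries.order_mul hv h1,
    HahnSeries.order_pow, order_vElt, HahnSeries.order_prod_laurent fun j _ => (hpos j).1,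
    HahnSeries.order_prod_laurent fun j _ => (hneg j).1,
    Finset.sum_congr rfl fun j _ => (hpos j).2, Finset.sum_congr rfl fun j _ => (hneg j).2, hc',
    Finset.sum_add_distrib, qwt, Prod.fst_sum, ← twoRhoLin_apply, map_sum]
  push_cast
  rw [Finset.sum_congr rfl fun j _ => (hξ j).1]
  simp only [← twoRhoLin_apply, map_neg, Finset.sum_neg_distrib, Finset.sum_const, nsmul_eq_mul]
  rw [← hcard]
  push_cast
  ring

end Path


end DoubleAffineDatum
end

/-! ### The order formula, the minimum, and its attainment. -/

theorem propositionP {ιX ιY V V' U U' : Type*} [Fintype ιX] [Fintype ιY]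
    [AddCommGroup V] [Module ℚ V] [AddCommGroup V'] [Module ℚ V']
    [AddCommGroup U] [Module ℚ U] [AddCommGroup U'] [Module ℚ U']
    (D : DoubleAffineDatum ιX ιY V V' U U') (F : Type*) [Field F]
    (u : D.W) (x : D.X) (m : D.W) (hm : D.IsMinCosetRep x m)
    (p : D.W) (n : ℕ) (word : Fin n → D.I)
    (hred : DoubleAffineDatum.IsReducedExpression m p word)
    (J : Finset (Fin n)) :
    ((DoubleAffineDatum.ord u p word J F : ℚ) =
        (D.length0 (DoubleAffineDatum.dir (DoubleAffineDatum.pathEnd u p word J)) : ℚ) - J.card -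
          D.twoRhoCheck (DoubleAffineDatum.qwt u p word J).1) ∧
      DoubleAffineDatum.ord u p word ∅ F ≤ DoubleAffineDatum.ord u p word J F ∧
      (DoubleAffineDatum.ord u p word J F = DoubleAffineDatum.ord u p word ∅ F ↔
        DoubleAffineDatum.IsQuantumAlcovePath u p word J) := by
  have hβ := fun j => DoubleAffineDatum.exists_pos_neg_beta p word hm hred j
  have hord := DoubleAffineDatum.ord_eq u p J F hβ
  have hord' := DoubleAffineDatum.ord_eq u p ∅ F hβ
  have hempty : (DoubleAffineDatum.qwt u p word ∅).1 = 0 := by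
    simp [DoubleAffineDatum.qwt, DoubleAffineDatum.foldsNeg]
  have hend : DoubleAffineDatum.pathEnd u p word ∅ = DoubleAffineDatum.zStart u p word := by
    simp [DoubleAffineDatum.pathEnd]
  rw [hempty, ← DoubleAffineDatum.twoRhoLin_apply, map_zero, Finset.card_empty, hend,
    Nat.cast_zero, sub_zero, sub_zero] at hord'
  -- With all folds included, the right side of the telescoped inequality is `ord(p_J)` and the left
  -- side is `ℓ(dir z_0) = ord(p_∅)`.
  obtain ⟨-, hle, hiff⟩ := DoubleAffineDatum.path_cost u p J hβ n.zero_le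
  rw [List.drop_zero, ← DoubleAffineDatum.sort_eq_filter, DoubleAffineDatum.sum_foldCost,
    ← DoubleAffineDatum.pathEnd_eq u p J hβ, DoubleAffineDatum.pathAt_zero] at hle hiff
  refine ⟨hord, ?_, ?_⟩
  · rw [← Int.cast_le (R := ℚ), hord, hord']
    linarith
  · rw [← Int.cast_inj (α := ℚ), hord, hord', DoubleAffineDatum.IsQuantumAlcovePath, ← hiff,
      eq_comm]
    simp only [sub_eq_add_neg, add_assoc]
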